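/- Let $\ell\ge 3$ be an integer and let $T\subset\mathbb R^3$ be a nondegenerate tetrahedron with vertices $\mathbf x_1,\dots,\mathbf x_4$ and barycentric coordinates $\lambda_1,\dots,\lambda_4$. Let $F_m$ be the face opposite to $\mathbf x_m$, let $\mathbf n_m$ be the unit outer normal to $T$ on $F_m$, and let $b_{F_m}=\prod_{i\ne m}\lambda_i$. For an edge, a face or the tetrahedron $G$, let $P_k(G)$ be the space of restrictions to $G$ of polynomials of total degree at most $k$, with $P_k(G)=\{0\}$ for $k<0$. For each $m$ let $q_{1,m},\dots,q_{d_0,m},q_{d_0+1,m}$ be a basis of $P_{\ell-2}(F_m)$ with $q_{d_0+1,m}=1$ (so $d_0=\ell(\ell-1)/2-1$). Then for each $m$ there are unique functions $\phi_{1,m},\dots,\phi_{d_0+1,m}\in b_{F_m}^2P_{\ell-2}(T)$ such that, for all $i,j$, $$\int_{F_m}\phi_{i,m}\,p\,\mathrm dS=0\ \ \forall p\in P_{\ell-3}(F_m),\qquad \int_{T}\phi_{i,m}\,p\,\mathrm d\mathbf x=0\ \ \forall p\in P_{\ell-4}(T),\qquad \frac1{|F_m|}\int_{F_m}\partial_{\mathbf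 n_m}\phi_{i,m}\,q_{j,m}\,\mathrm dS=\delta_{ij},$$ and the enriched space $$\mathcal P_\ell^+(T)=P_\ell(T)+\operatorname{span}\{\phi_{i,m}: 1\le m\le 4,\ 1\le i\le d_0\}$$ is unisolvent for the degrees of freedom $$\frac1{|e|}\int_e v\,q\,\mathrm ds,\ q\in P_{\ell-2}(e),\ \text{on the six edges } e;\qquad \frac1{|F_m|}\int_{F_m}v\,q\,\mathrm dS,\ q\in P_{\ell-3}(F_m),\ 1\le m\le 4;$$ $$\frac1{|T|}\int_T v\,q\,\mathrm d\mathbf x,\ q\in P_{\ell-4}(T);\qquad \frac1{|F_m|}\int_{F_m}\partial_{\mathbf n_m}v\,q\,\mathrm dS,\ q\in P_{\ell-2}(F_m),\ 1\le m\le 4.$$ That is, for every prescription of these moments (one linear functional on each of the spaces of test polynomials $q$) there is exactly one $v\in\mathcal P_\ell^+(T)$ having them. -/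

import Mathlib

open MeasureTheory Module
open scoped RealInnerProductSpace

noncomputable section

namespace TetraFE

/-- Three-dimensional Euclidean space. -/
abbrev E3 : Type := EuclideanSpace ℝ (Fin 3)

/-! ### Polynomial spaces -/

/-- Evaluation of a polynomial in three variables, as a linear map to real functions on `E3`. -/
def evalMap : MvPolynomial (Fin 3) ℝ →ₗ[ℝ] (E3 → ℝ) :=
  LinearMap.pi fun x => (MvPolynomial.aeval (x : Fin 3 → ℝ)).toLinearMap

/-- Polynomial functions on `E3` of total degree at most `k`. The degree is an integer, so that
for `k < 0` this is the zero space. -/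
def polySpace (k : ℤ) : Submodule ℝ (E3 → ℝ) :=
  (MvPolynomial.restrictSupport ℝ {a : Fin 3 →₀ ℕ | (a.degree : ℤ) ≤ k}).map evalMap

/-- `P_k(G)`: the functions on the set `G` that are restrictions of polynomials of degree at
most `k`. -/
def polyOn (k : ℤ) (G : Set E3) : Submodule ℝ (G → ℝ) :=
  (polySpace k).map (LinearMap.funLeft ℝ ℝ (Subtype.val : G → E3))

/-! ### The tetrahedron, its faces and edges -/

/-- A nondegenerate tetrahedron: four affinely independent vertices. -/
abbrev Tetra : Type := Affine.Simplex ℝ E3 3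

/-- The six edges of a tetrahedron are indexed by the two-element sets of vertices. -/
abbrev EdgeIdx : Type := {s : Finset (Fin 4) // s.card = 2}

/-- The edge joining the two vertices in `e`. -/
def edge (T : Tetra) (e : EdgeIdx) : Affine.Simplex ℝ E3 1 := T.face (m := 1) e.2

/-- The face triangle `F_m` opposite to the vertex `m`. -/
def face (T : Tetra) (m : Fin 4) : Affine.Simplex ℝ E3 2 := T.faceOpposite m

/-- The vertices of a tetrahedron as an affine basis of space. -/
def vertexBasis (T : Tetra) : AffineBasis (Fin 4) ℝ E3 where
  toFun := T.points
  ind' := T.independent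
  tot' := by
    rw [T.independent.affineSpan_eq_top_iff_card_eq_finrank_add_one]
    simp

/-- The barycentric coordinate `λ_i`: the affine function with value `1` at the vertex `i` and
`0` at the other vertices. -/
def bary (T : Tetra) (i : Fin 4) : E3 → ℝ := (vertexBasis T).coord i

theorem bary_vertex (T : Tetra) (i j : Fin 4) :
    bary T i (T.points j) = if i = j then 1 else 0 :=
  (vertexBasis T).coord_apply i j

/-- The face bubble `b_{F_m}`: the product of the barycentric coordinates of the three vertices
of `F_m`. -/
def faceBubble (T : Tetra) (m : Fin 4) : E3 → ℝ := fun x => ∏ i ∈ {m}ᶜ, bary T i x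

/-- The space `b_{F_m}² P_k(T)`. -/
def bubbleSpace (T : Tetra) (m : Fin 4) (k : ℤ) : Submodule ℝ (E3 → ℝ) :=
  (polySpace k).map (LinearMap.mulLeft ℝ (faceBubble T m ^ 2))

/-- The unit outer normal `n_m` of `T` on the face `F_m`: the normalized vector from the vertex
`m` to its orthogonal projection onto the plane of `F_m`. -/
def outerNormal (T : Tetra) (m : Fin 4) : E3 :=
  (T.height m)⁻¹ • (T.altitudeFoot m - T.points m)

theorem norm_outerNormal (T : Tetra) (m : Fin 4) : ‖outerNormal T m‖ = 1 := by
  have h : ‖T.altitudeFoot m - T.points m‖ = T.height m := by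
    rw [Affine.Simplex.height, dist_eq_norm, norm_sub_rev]
  have hp := T.height_pos m
  rw [outerNormal, norm_smul, h, norm_inv, Real.norm_of_nonneg hp.le, inv_mul_cancel₀ hp.ne']

theorem inner_outerNormal_vertex (T : Tetra) {m j : Fin 4} (h : m ≠ j) :
    ⟪T.points m - T.points j, outerNormal T m⟫ = -T.height m := by
  have h1 := T.inner_vsub_vsub_altitudeFoot_eq_height_sq h
  have hp := T.height_pos m
  simp only [vsub_eq_sub] at h1
  rw [outerNormal, inner_smul_right, ← neg_sub (T.points m) (T.altitudeFoot m), inner_neg_right,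
    h1]
  field_simp

theorem inner_outerNormal_face (T : Tetra) {m i j : Fin 4} (hi : m ≠ i) (hj : m ≠ j) :
    ⟪T.points i - T.points j, outerNormal T m⟫ = 0 := by
  have h1 := inner_outerNormal_vertex T hi
  have h2 := inner_outerNormal_vertex T hj
  rw [← sub_sub_sub_cancel_left (T.points j) (T.points i) (T.points m), inner_sub_left, h1, h2,
    sub_self]

/-- The normal derivative `∂_{n_m} v`. -/
def normalDeriv (T : Tetra) (m : Fin 4) (v : E3 → ℝ) : E3 → ℝ :=
  fun x => fderiv ℝ v x (outerNormal T m)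

/-! ### Degrees of freedom -/

/-- The moment `|S|⁻¹ ∫_S f q` of a function `f` against a function `q` on the (closed)
`d`-dimensional simplex `S`, with respect to the `d`-dimensional Euclidean measure on `S`
(length for `d = 1`, surface area for `d = 2`, volume for `d = 3`). -/
def moment {d : ℕ} (S : Affine.Simplex ℝ E3 d) (f : E3 → ℝ) (q : S.closedInterior → ℝ) : ℝ :=
  ⨍ x : S.closedInterior, f x * q x ∂μHE[d]

/-- The space `V` of polynomial shape functions on `T` is unisolvent for the degrees of freedom
* `|e|⁻¹ ∫_e v q`, `q ∈ P_{ℓ-2}(e)`, on all edges `e`,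
* `|F|⁻¹ ∫_F v q`, `q ∈ P_{ℓ-3}(F)`, on all faces `F`,
* `|T|⁻¹ ∫_T v q`, `q ∈ P_{ℓ-4}(T)`,
* `|F|⁻¹ ∫_F ∂_n v q`, `q ∈ P_{ℓ-2}(F)`, on all faces `F`:

for all prescribed values, i.e. linear functionals on the spaces of test polynomials `q`, there is
exactly one `v ∈ V` with these moments. -/
def Unisolvent (T : Tetra) (ℓ : ℕ) (V : Submodule ℝ (E3 → ℝ)) : Prop :=
  ∀ (a : ∀ e : EdgeIdx, Dual ℝ (polyOn ((ℓ : ℤ) - 2) (edge T e).closedInterior))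
    (b : ∀ m : Fin 4, Dual ℝ (polyOn ((ℓ : ℤ) - 3) (face T m).closedInterior))
    (c : Dual ℝ (polyOn ((ℓ : ℤ) - 4) T.closedInterior))
    (d : ∀ m : Fin 4, Dual ℝ (polyOn ((ℓ : ℤ) - 2) (face T m).closedInterior)),
    ∃! v : E3 → ℝ, v ∈ V ∧
      (∀ e q, moment (edge T e) v q.1 = a e q) ∧
      (∀ m q, moment (face T m) v q.1 = b m q) ∧
      (∀ q, moment T v q.1 = c q) ∧
      (∀ m q, moment (face T m) (normalDeriv T m v) q.1 = d m q)

/-! ### The enriched space -/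

/-- `φ` is the group of nodal basis functions of `b_{F_m}² P_{ℓ-2}(T)` belonging to the normal
derivative moments on `F_m`, with respect to a basis `q` of the test space `P_{ℓ-2}(F_m)`: the
moments of each `φ i` of order `ℓ - 3` on `F_m` and of order `ℓ - 4` on `T` vanish, and the normal
derivative moments are dual to `φ`. -/
def IsNodalFamily (T : Tetra) (ℓ : ℕ) (m : Fin 4) {ι : Type*} [DecidableEq ι]
    (q : Basis ι ℝ (polyOn ((ℓ : ℤ) - 2) (face T m).closedInterior)) (φ : ι → E3 → ℝ) : Prop :=
  ∀ i, φ i ∈ bubbleSpace T m ((ℓ : ℤ) - 2) ∧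
    (∀ p ∈ polyOn ((ℓ : ℤ) - 3) (face T m).closedInterior, moment (face T m) (φ i) p = 0) ∧
    (∀ p ∈ polyOn ((ℓ : ℤ) - 4) T.closedInterior, moment T (φ i) p = 0) ∧
    ∀ j, moment (face T m) (normalDeriv T m (φ i)) (q j).1 = if i = j then 1 else 0

/-- The enriched space `P_ℓ⁺(T)`: the sum of `P_ℓ(T)` and the span of all `φ m i` except the
dropped functions `φ m (i₀ m)`, one on each face. -/
def enrichedSpace (ℓ : ℕ) {ι : Fin 4 → Type*} (i₀ : ∀ m, ι m) (φ : ∀ m, ι m → E3 → ℝ) :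
    Submodule ℝ (E3 → ℝ) :=
  polySpace ℓ ⊔ Submodule.span ℝ {v | ∃ m i, i ≠ i₀ m ∧ v = φ m i}

end TetraFE

end

open TetraFE

/-!
The proof takes place in the polynomial ring in the four barycentric coordinates. A polynomial
function of degree at most `n` is the value `baryEval T P` of a homogeneous `P` of degree `n`,
restriction to a face of `T` sets the other variables to zero, the mean over a face with vertex set
`s` is up to a factorial the explicit functional `dirichlet s` (Dirichlet's formula
`∫ λ^α = α! / (|α| + d)!` on the reference simplex), and `∂_{n_m}` is the derivation `dirDeriv c`
whose slopes `c i` satisfy `∑ c i = 0` and `c m ≠ 0`. So the geometry of `T` enters only through the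
slopes, and two injectivity statements remain. In both, the number of moments does not exceed the
number of coefficients (`finrank_polyOn_le`), so that injectivity gives bijectivity.

*Bubbles* (`eq_zero_of_bubble_moments`). Let `b² P` with `b = b_{F_m}` and `P` of degree `ℓ - 2`
have vanishing moments on `F = F_m`, on `T` and of the normal derivative on `F`. As `∂_i P` has
degree `ℓ - 3`, `∫_F b² P ∂_i P = 0`, so that `0 = ∫_F ∂_n (b² P) P = ∫_F ∂_n (b² P²)`. Integration
by parts in the plane of `F` shows that the derivatives `∂_i`, `i ≠ m`, of `b² P²` all have the same
integral over `F`, and that of `∂_m` is zero, as `∂_m b = 0` and `∫_F b² P ∂_m P = 0`; since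
`∑ c i = 0`, the sum is `-c m ∫_F ∂_k (b² P²) = -c m ∫_F ∂_k (b²) P²` for any `k ≠ m`, where
`∂_k (b²) ≥ 0`. Hence `P` vanishes on `F` and `P = λ_m R`. Now `∂_n (b² P) = c m b² R` on `F`, whose
moment against `R` gives `R = λ_m S`, and the moment of `b² λ_m² S` against `S` over `T` gives
`S = 0`.

*Polynomials* (`eq_zero_of_moments`). Let `P` of degree `ℓ` have vanishing moments on the edges, the
faces and `T`, and normal derivatives of mean zero on the faces. Once such a polynomial vanishes at
the vertices, it vanishes successively on edges, faces and `T`, being divisible by the bubble of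
each of these simplices. The values at the vertices are corrected by the four functions
`rodriguesPoly (ℓ - 1) m`, up to a constant the derivative `g` of order `ℓ - 1` of
`s ^ ℓ * (1 - s) ^ (ℓ - 1)` at `s = λ_m`: like Legendre and Jacobi polynomials they are orthogonal
to the test polynomials, here on all edges and faces and on `T` simultaneously. So `P` is a
combination of these four. The means of their normal derivatives form a diagonal matrix with nonzero
diagonal: on `F_k`, `k ≠ m`, the mean is a multiple of `∫ g' (s) (1 - s) ds = ∫ g = 0`, and on `F_m`
it is a multiple of `g' (0) ≠ 0`.

*The enriched space* (`unisolvent_of_isNodalFamily`). The bubbles on `F_m` and their normal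
derivatives vanish on the edges and on the other faces, and the nodal functions in the enriched
space have zero moments on `F_m` and `T` as well and normal derivatives of mean zero. So the moments
of `W + S`, with `W` in `P_ℓ(T)` and `S` in the span of the bubbles, are in triangular form: `W` is
determined by the moments on edges, faces and `T` and the means of the normal derivatives, `S` by
the remaining normal derivative moments.
-/

noncomputable section

namespace TetraFE

open MvPolynomial (IsHomogeneous)

section Integration

open scoped Nat

/-! ### Integration over the reference simplex -/

theorem integral_pow_mul_one_sub_pow (a b : ℕ) :
    ∫ s in (0 : ℝ)..1, s ^ a * (1 - s) ^ b = (a ! * b ! : ℝ) / (a + b + 1)! := by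
  induction b generalizing a with
  | zero =>
    simp only [pow_zero, mul_one, integral_pow, Nat.factorial_zero, Nat.cast_one, add_zero,
      Nat.factorial_succ, Nat.cast_mul]
    have : (a ! : ℝ) ≠ 0 := by positivity
    field_simp
    simp
  | succ b ih =>
    have key : ∫ s in (0 : ℝ)..1,
        ((a + 1 : ℝ) * s ^ a * (1 - s) ^ (b + 1) - (b + 1) * (s ^ (a + 1) * (1 - s) ^ b)) = 0 := by
      rw [intervalIntegral.integral_eq_sub_of_hasDerivAt
        (f := fun s : ℝ => s ^ (a + 1) * (1 - s) ^ (b + 1))]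
      · simp
      · intro x _
        have h1 := (hasDerivAt_id x).pow (a + 1)
        have h2 := ((hasDerivAt_id x).const_sub 1).pow (b + 1)
        refine (h1.mul h2).congr_deriv ?_
        simp
        ring
      · exact (by fun_prop : Continuous _).intervalIntegrable _ _
    rw [intervalIntegral.integral_sub ((by fun_prop : Continuous _).intervalIntegrable _ _)
      ((by fun_prop : Continuous _).intervalIntegrable _ _),
      intervalIntegral.integral_const_mul, ih] at key
    simp_rw [mul_assoc] at key
    rw [intervalIntegral.integral_const_mul] at key
    have h3 : (a + 1 : ℝ) ≠ 0 := by positivity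
    apply mul_left_cancel₀ h3
    rw [sub_eq_zero.mp key]
    have : a + 1 + b + 1 = a + (b + 1) + 1 := by ring
    rw [this, Nat.factorial_succ a, Nat.factorial_succ b]
    push_cast
    ring

/-- The reference simplex `{t | t ≥ 0, ∑ t ≤ 1}` in `ℝᵈ`. -/
def refSimplex (d : ℕ) : Set (Fin d → ℝ) := {t | (∀ k, 0 ≤ t k) ∧ ∑ k, t k ≤ 1}

/-- The barycentric coordinates of a point of `ℝᵈ` with respect to the reference simplex; the
coordinate `0` belongs to the origin. -/
def refBary {d : ℕ} (t : Fin d → ℝ) : Fin (d + 1) → ℝ := Fin.cons (1 - ∑ k, t k) t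

theorem continuous_refBary {d : ℕ} : Continuous (refBary (d := d)) := by
  refine continuous_pi fun k => ?_
  refine Fin.cases ?_ (fun k => ?_) k
  · simp only [refBary, Fin.cons_zero]; fun_prop
  · simp only [refBary, Fin.cons_succ]; fun_prop

theorem sum_refBary {d : ℕ} (t : Fin d → ℝ) : ∑ k, refBary t k = 1 := by
  simp [refBary, Fin.sum_univ_succ]

theorem isClosed_refSimplex (d : ℕ) : IsClosed (refSimplex d) := by
  have h : refSimplex d = Set.Ici 0 ∩ {t | ∑ k, t k ≤ 1} := by
    ext t
    simp [refSimplex, Pi.le_def]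
  rw [h]
  exact isClosed_Ici.inter (isClosed_le (by fun_prop) continuous_const)

theorem isCompact_refSimplex (d : ℕ) : IsCompact (refSimplex d) := by
  refine (isCompact_Icc (a := (0 : Fin d → ℝ)) (b := 1)).of_isClosed_subset
    (isClosed_refSimplex d) fun t ht => ⟨ht.1, fun k => ?_⟩
  exact (Finset.single_le_sum (fun i _ => ht.1 i) (Finset.mem_univ k)).trans ht.2

theorem cons_mem_refSimplex_iff {d : ℕ} {s : ℝ} (hs : s < 1) (y : Fin d → ℝ) :
    (Fin.cons s ((1 - s) • y) : Fin (d + 1) → ℝ) ∈ refSimplex (d + 1) ↔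
      0 ≤ s ∧ y ∈ refSimplex d := by
  have h : 0 < 1 - s := by linarith
  simp only [refSimplex, Set.mem_ofPred_eq, Fin.forall_fin_succ, Fin.cons_zero, Fin.cons_succ,
    Fin.sum_univ_succ, Pi.smul_apply, smul_eq_mul, ← Finset.mul_sum, mul_nonneg_iff_of_pos_left h,
    and_assoc]
  have : s + (1 - s) * ∑ i, y i ≤ 1 ↔ ∑ i, y i ≤ 1 := by
    constructor
    · intro h1
      by_contra! h2
      nlinarith
    · intro h1
      nlinarith
  rw [this]

/-- Slicing the reference simplex parallel to a facet. -/
theorem setIntegral_refSimplex_succ {d : ℕ} {f : (Fin (d + 1) → ℝ) → ℝ} (hf : Continuous f) :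
    ∫ t in refSimplex (d + 1), f t =
      ∫ s in (0 : ℝ)..1, (1 - s) ^ d * ∫ y in refSimplex d, f (Fin.cons s ((1 - s) • y)) := by
  have hm := (isClosed_refSimplex (d + 1)).measurableSet
  have hmp := (volume_preserving_piFinSuccAbove (fun _ : Fin (d + 1) => ℝ) 0).symm
  have hint : Integrable ((refSimplex (d + 1)).indicator f) :=
    (integrable_indicator_iff hm).mpr
      (hf.continuousOn.integrableOn_compact (isCompact_refSimplex _))
  rw [← integral_indicator hm, ← hmp.integral_comp',
    Measure.volume_eq_prod, integral_prod (fun z => (refSimplex (d + 1)).indicator f _)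
      ((hmp.integrable_comp_emb (MeasurableEquiv.measurableEmbedding _)).mpr hint),
    intervalIntegral.integral_of_le zero_le_one, integral_Ioc_eq_integral_Ioo,
    ← integral_indicator measurableSet_Ioo]
  refine integral_congr_ae ?_
  have hne : ∀ c : ℝ, ∀ᵐ s : ℝ, s ≠ c := fun c => by simp [ae_iff]
  filter_upwards [hne 0, hne 1] with s h0 h1
  have hcons : ∀ z : Fin d → ℝ,
      (MeasurableEquiv.piFinSuccAbove (fun _ : Fin (d + 1) => ℝ) 0).symm (s, z) = Fin.cons s z := by
    intro z
    simp [MeasurableEquiv.piFinSuccAbove]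
    rfl
  simp_rw [hcons]
  by_cases hs : s ∈ Set.Ioo (0 : ℝ) 1
  · have hpos : 0 < 1 - s := by linarith [hs.2]
    rw [Set.indicator_of_mem hs]
    have := Measure.integral_comp_smul_of_nonneg (volume : Measure (Fin d → ℝ))
      (fun z => (refSimplex (d + 1)).indicator f (Fin.cons s z)) (1 - s) (hR := hpos.le)
    rw [Module.finrank_fin_fun, smul_eq_mul] at this
    rw [← integral_indicator (isClosed_refSimplex d).measurableSet]
    have h2 : ∀ y : Fin d → ℝ, (refSimplex (d + 1)).indicator f (Fin.cons s ((1 - s) • y)) =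
        (refSimplex d).indicator (fun y => f (Fin.cons s ((1 - s) • y))) y := by
      intro y
      by_cases hy : y ∈ refSimplex d
      · rw [Set.indicator_of_mem hy, Set.indicator_of_mem]
        exact (cons_mem_refSimplex_iff hs.2 y).mpr ⟨hs.1.le, hy⟩
      · rw [Set.indicator_of_notMem hy, Set.indicator_of_notMem]
        exact fun h => hy ((cons_mem_refSimplex_iff hs.2 y).mp h).2
    simp_rw [h2] at this
    rw [this]
    field_simp
  · rw [Set.indicator_of_notMem hs]
    refine integral_eq_zero_of_ae (Filter.Eventually.of_forall fun z => ?_)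
    refine Set.indicator_of_notMem (fun hz => hs ?_) _
    have hz0 := hz.1 0
    have hz1 := (Finset.single_le_sum (fun i _ => hz.1 i) (Finset.mem_univ 0)).trans hz.2
    simp only [Fin.cons_zero] at hz0 hz1
    exact ⟨lt_of_le_of_ne hz0 h0.symm, lt_of_le_of_ne hz1 h1⟩

/-- Dirichlet's formula for the integrals of the barycentric monomials. -/
theorem setIntegral_refSimplex_prod_pow (d : ℕ) (a : Fin (d + 1) → ℕ) :
    ∫ t in refSimplex d, ∏ k, refBary t k ^ a k =
      (∏ k, ((a k)! : ℝ)) / (∑ k, a k + d)! := by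
  induction d with
  | zero =>
    have h : refSimplex 0 = Set.univ := by ext; simp [refSimplex]
    have hv : (volume : Measure (Fin 0 → ℝ)) = Measure.dirac default := by
      rw [volume_pi, Measure.pi_of_empty]
      congr 1
      exact Subsingleton.elim _ _
    rw [h, Measure.restrict_univ, hv, integral_dirac]
    simp [refBary]
    exact (div_self (by positivity)).symm
  | succ d ih =>
    have hc : Continuous fun t : Fin (d + 1) → ℝ => ∏ k, refBary t k ^ a k :=
      continuous_finsetProd _ fun k _ => ((continuous_apply k).comp continuous_refBary).pow _
    rw [setIntegral_refSimplex_succ hc]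
    -- at `(s, (1 - s) y)` the coordinate `1` is `s`, and the others are `1 - s` times those of `y`
    set a' : Fin (d + 1) → ℕ := Fin.cons (a 0) fun k => a k.succ.succ with ha'
    have hb : ∀ (s : ℝ) (y : Fin d → ℝ),
        ∏ k, refBary (Fin.cons s ((1 - s) • y) : Fin (d + 1) → ℝ) k ^ a k =
          s ^ a 1 * (1 - s) ^ (∑ k, a' k) * ∏ k, refBary y k ^ a' k := by
      intro s y
      have e0 : refBary (Fin.cons s ((1 - s) • y) : Fin (d + 1) → ℝ) 0 = (1 - s) * refBary y 0 := by
        simp only [refBary, Fin.cons_zero, Fin.sum_univ_succ, Fin.cons_succ, Pi.smul_apply,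
          smul_eq_mul, ← Finset.mul_sum]
        ring
      have e1 : refBary (Fin.cons s ((1 - s) • y) : Fin (d + 1) → ℝ) (Fin.succ 0) = s := by
        simp [refBary]
      have e2 : ∀ k : Fin d, refBary (Fin.cons s ((1 - s) • y) : Fin (d + 1) → ℝ) k.succ.succ =
          (1 - s) * refBary y k.succ := by
        simp [refBary]
      rw [← Finset.prod_pow_eq_pow_sum, mul_assoc, ← Finset.prod_mul_distrib,
        Fin.prod_univ_succ, Fin.prod_univ_succ, Fin.prod_univ_succ (n := d), e0, e1]
      simp_rw [e2, ← mul_pow]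
      simp only [ha', Fin.cons_zero, Fin.cons_succ, Fin.succ_zero_eq_one]
      ring
    have hsum : ∑ k, a k = a 1 + ∑ k, a' k := by
      rw [Fin.sum_univ_succ, Fin.sum_univ_succ, Fin.sum_univ_succ (n := d)]
      simp [ha']
      ring
    have hprod : ∏ k, ((a k)! : ℝ) = (a 1)! * ∏ k, ((a' k)! : ℝ) := by
      rw [Fin.prod_univ_succ, Fin.prod_univ_succ, Fin.prod_univ_succ (n := d)]
      simp [ha']
      ring
    simp_rw [hb, integral_const_mul, ih]
    have : ∀ s : ℝ, (1 - s) ^ d * (s ^ a 1 * (1 - s) ^ (∑ k, a' k) *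
        ((∏ k, ((a' k)! : ℝ)) / (∑ k, a' k + d)!)) =
        ((∏ k, ((a' k)! : ℝ)) / (∑ k, a' k + d)!) * (s ^ a 1 * (1 - s) ^ (∑ k, a' k + d)) := by
      intro s; ring
    simp_rw [this, intervalIntegral.integral_const_mul, integral_pow_mul_one_sub_pow]
    rw [hprod, hsum]
    have h1 : ((∑ k, a' k + d)! : ℝ) ≠ 0 := by positivity
    have h2 : a 1 + (∑ k, a' k + d) + 1 = a 1 + ∑ k, a' k + (d + 1) := by ring
    rw [h2]
    field_simp

theorem volume_refSimplex (d : ℕ) : volume.real (refSimplex d) = 1 / d ! := by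
  have h := setIntegral_refSimplex_prod_pow d 0
  simpa using h

/-! ### Moments on a simplex in space -/

/-- The point of the simplex `S` with the barycentric coordinates of `t` in the reference
simplex. -/
def simplexPoint {d : ℕ} (S : Affine.Simplex ℝ E3 d) (t : Fin d → ℝ) : E3 :=
  ∑ k, refBary t k • S.points k

/-- The linear part of `simplexPoint S`. -/
def simplexLinear {d : ℕ} (S : Affine.Simplex ℝ E3 d) : EuclideanSpace ℝ (Fin d) →ₗ[ℝ] E3 :=
  (Fintype.linearCombination ℝ fun k : Fin d => S.points k.succ - S.points 0) ∘ₗ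
    (WithLp.linearEquiv 2 ℝ (Fin d → ℝ)).toLinearMap

theorem simplexPoint_eq {d : ℕ} (S : Affine.Simplex ℝ E3 d) (t : Fin d → ℝ) :
    simplexPoint S t = S.points 0 + simplexLinear S (WithLp.toLp 2 t) := by
  simp only [simplexPoint, refBary, Fin.sum_univ_succ, Fin.cons_zero, Fin.cons_succ, simplexLinear,
    LinearMap.comp_apply, Fintype.linearCombination_apply, LinearEquiv.coe_coe,
    WithLp.linearEquiv_apply, smul_sub, Finset.sum_sub_distrib, sub_smul, one_smul,
    Finset.sum_smul]
  simp
  abel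

theorem simplexLinear_injective {d : ℕ} (S : Affine.Simplex ℝ E3 d) :
    Function.Injective (simplexLinear S) := by
  have h := (affineIndependent_iff_linearIndependent_vsub ℝ _ (0 : Fin (d + 1))).mp S.independent
  have h2 : LinearIndependent ℝ fun k : Fin d => S.points k.succ - S.points 0 :=
    h.comp (fun k : Fin d => (⟨k.succ, Fin.succ_ne_zero k⟩ : {x : Fin (d + 1) // x ≠ 0}))
      fun a b hab => by simpa using hab
  rw [linearIndependent_iff_injective_fintypeLinearCombination] at h2
  exact h2.comp (WithLp.linearEquiv 2 ℝ (Fin d → ℝ)).injective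

theorem continuous_simplexPoint {d : ℕ} (S : Affine.Simplex ℝ E3 d) :
    Continuous (simplexPoint S) :=
  continuous_finsetSum _ fun k _ =>
    ((continuous_apply k).comp continuous_refBary).smul continuous_const

theorem measurableEmbedding_simplexPoint {d : ℕ} (S : Affine.Simplex ℝ E3 d) :
    MeasurableEmbedding (simplexPoint S) := by
  refine (continuous_simplexPoint S).measurableEmbedding fun a b hab => ?_
  rw [simplexPoint_eq, simplexPoint_eq] at hab
  exact WithLp.toLp_injective 2 (simplexLinear_injective S (add_left_cancel hab))

theorem image_simplexPoint {d : ℕ} (S : Affine.Simplex ℝ E3 d) :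
    simplexPoint S '' refSimplex d = S.closedInterior := by
  ext x
  constructor
  · rintro ⟨t, ht, rfl⟩
    refine ⟨refBary t, sum_refBary t, fun k => ?_, ?_⟩
    · refine Fin.cases ?_ (fun k => ?_) k
      · have : 0 ≤ ∑ k, t k := Finset.sum_nonneg fun k _ => ht.1 k
        simpa [refBary] using ⟨ht.2, this⟩
      · simp only [refBary, Fin.cons_succ]
        exact ⟨ht.1 k, (Finset.single_le_sum (fun i _ => ht.1 i) (Finset.mem_univ k)).trans ht.2⟩
    · rw [Finset.affineCombination_eq_linear_combination _ _ _ (sum_refBary t)]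
      rfl
  · rintro ⟨w, hw, hI, rfl⟩
    have h0 : 1 - ∑ k : Fin d, w k.succ = w 0 := by
      rw [← hw, Fin.sum_univ_succ]; ring
    have h1 : refBary (fun k : Fin d => w k.succ) = w := by
      ext k
      refine Fin.cases ?_ (fun k => ?_) k <;> simp [refBary, h0]
    refine ⟨fun k => w k.succ, ⟨fun k => (hI _).1, ?_⟩, ?_⟩
    · linarith [(hI 0).1]
    · rw [Finset.affineCombination_eq_linear_combination _ _ _ hw, simplexPoint, h1]

/-- The Euclidean measure on a simplex is a multiple of the image of Lebesgue measure on the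
reference simplex. -/
theorem exists_restrict_closedInterior_eq_smul_map {d : ℕ} (S : Affine.Simplex ℝ E3 d) :
    ∃ c : ENNReal, c ≠ 0 ∧ c ≠ ⊤ ∧ (μHE[d] : Measure E3).restrict S.closedInterior =
      c • (volume.restrict (refSimplex d)).map (simplexPoint S) := by
  refine ⟨ENNReal.ofReal (simplexLinear S).normDet, ?_, ENNReal.ofReal_ne_top, ?_⟩
  · have h : (simplexLinear S).normDet ≠ 0 :=
      ((simplexLinear S).normDet_ne_zero_tfae.out 1 0).mp
        (LinearMap.ker_eq_bot.mpr (simplexLinear_injective S))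
    simpa using lt_of_le_of_ne (simplexLinear S).normDet_nonneg h.symm
  · have hE := measurableEmbedding_simplexPoint S
    have himg : ∀ s : Set (Fin d → ℝ), (μHE[d] : Measure E3) (simplexPoint S '' s) =
        ENNReal.ofReal (simplexLinear S).normDet * volume s := by
      intro s
      have h := (simplexLinear S).euclideanHausdorffMeasure_image_eq_normDet_mul_volume
        (WithLp.toLp 2 '' s)
      rw [finrank_euclideanSpace_fin] at h
      have h1 : simplexPoint S '' s =
          (fun x => S.points 0 + x) '' (simplexLinear S '' (WithLp.toLp 2 '' s)) := by
        simp only [Set.image_image, simplexPoint_eq]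
      rw [h1, (isometry_add_left (S.points 0)).euclideanHausdorffMeasure_image, h,
        ← (PiLp.volume_preserving_toLp (Fin d)).measure_preimage_emb
          (MeasurableEquiv.toLp 2 (Fin d → ℝ)).measurableEmbedding,
        Set.preimage_image_eq _ (WithLp.toLp_injective 2)]
    ext A hA
    rw [Measure.restrict_apply hA, Measure.smul_apply, hE.map_apply, smul_eq_mul,
      Measure.restrict_apply (hE.measurable hA), ← himg, ← image_simplexPoint,
      Set.image_preimage_inter]

/-- The factor `d !` is the inverse of the volume of the reference simplex; the Jacobian of the
parametrization cancels in the mean. -/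
theorem moment_eq_setIntegral {d : ℕ} (S : Affine.Simplex ℝ E3 d) (f g : E3 → ℝ) :
    moment S f (fun x => g x) =
      d ! * ∫ t in refSimplex d, f (simplexPoint S t) * g (simplexPoint S t) := by
  obtain ⟨c, hc0, hct, hc⟩ := exists_restrict_closedInterior_eq_smul_map S
  have hK : MeasurableSet S.closedInterior := S.isClosed_closedInterior.measurableSet
  have hval : MeasurableEmbedding (Subtype.val : S.closedInterior → E3) :=
    MeasurableEmbedding.subtype_coe hK
  have hmap : (μHE[d] : Measure S.closedInterior).map Subtype.val =
      c • (volume.restrict (refSimplex d)).map (simplexPoint S) := by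
    rw [isometry_subtype_coe.map_euclideanHausdorffMeasure, Subtype.range_coe, hc]
  have hint : ∫ x : S.closedInterior, f x * g x ∂μHE[d] =
      c.toReal * ∫ t in refSimplex d, f (simplexPoint S t) * g (simplexPoint S t) := by
    rw [← hval.integral_map (fun x => f x * g x), hmap, integral_smul_measure,
      (measurableEmbedding_simplexPoint S).integral_map, smul_eq_mul]
  have huniv : (μHE[d] : Measure S.closedInterior).real Set.univ = c.toReal * (1 / d !) := by
    have h : (μHE[d] : Measure S.closedInterior) Set.univ = c * volume (refSimplex d) := by
      rw [← Set.preimage_univ (f := (Subtype.val : S.closedInterior → E3)), ← hval.map_apply, hmap,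
        Measure.smul_apply, (measurableEmbedding_simplexPoint S).map_apply]
      simp
    rw [measureReal_def, h, ENNReal.toReal_mul, ← measureReal_def, volume_refSimplex]
  have hc' : c.toReal ≠ 0 := ENNReal.toReal_ne_zero.mpr ⟨hc0, hct⟩
  have hd : (d ! : ℝ) ≠ 0 := by positivity
  rw [moment, average_eq, huniv, hint, smul_eq_mul]
  field_simp

end Integration

section Dirichlet

open scoped Nat

/-! ### The Dirichlet functionals on polynomials in barycentric coordinates -/

theorem eval_smul_of_isHomogeneous {σ : Type*} {R : MvPolynomial σ ℝ} {n : ℕ}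
    (hR : R.IsHomogeneous n) (c : ℝ) (x : σ → ℝ) :
    MvPolynomial.eval (c • x) R = c ^ n * MvPolynomial.eval x R := by
  rw [MvPolynomial.eval_eq, MvPolynomial.eval_eq, Finset.mul_sum]
  refine Finset.sum_congr rfl fun α hα => ?_
  rw [hR.degree_eq_sum_deg_support hα, ← Finset.prod_pow_eq_pow_sum, mul_left_comm,
    ← Finset.prod_mul_distrib]
  simp [mul_pow]

variable {σ : Type*} [DecidableEq σ]

/-- The integral of the monomial with exponent `α` in the barycentric coordinates over the
reference simplex with vertex set `s`; the barycentric coordinates outside `s` are zero. -/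
def dirichletWeight (s : Finset σ) (α : σ →₀ ℕ) : ℝ :=
  if α.support ⊆ s then (∏ i ∈ s, ((α i)! : ℝ)) / (α.degree + s.card - 1)! else 0

/-- Integration over the reference simplex with vertex set `s`, as a functional on polynomials in
the barycentric coordinates. -/
def dirichlet (s : Finset σ) : MvPolynomial σ ℝ →ₗ[ℝ] ℝ :=
  (MvPolynomial.basisMonomials σ ℝ).constr ℝ (dirichletWeight s)

theorem dirichlet_monomial (s : Finset σ) (α : σ →₀ ℕ) (r : ℝ) :
    dirichlet s (MvPolynomial.monomial α r) = r * dirichletWeight s α := by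
  have h : MvPolynomial.monomial α r = r • MvPolynomial.basisMonomials σ ℝ α := by
    simp [MvPolynomial.smul_monomial]
  rw [h, map_smul, dirichlet, Basis.constr_basis, smul_eq_mul]

/-- Restriction to the face with vertex set `s`: the variables outside `s` are set to zero. -/
def faceRestrict (s : Finset σ) : MvPolynomial σ ℝ →ₐ[ℝ] MvPolynomial σ ℝ :=
  MvPolynomial.aeval fun i => if i ∈ s then MvPolynomial.X i else 0

theorem faceRestrict_X (s : Finset σ) (i : σ) :
    faceRestrict s (MvPolynomial.X i) = if i ∈ s then MvPolynomial.X i else 0 :=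
  MvPolynomial.aeval_X _ _

theorem faceRestrict_monomial (s : Finset σ) (α : σ →₀ ℕ) (r : ℝ) :
    faceRestrict s (MvPolynomial.monomial α r) =
      if α.support ⊆ s then MvPolynomial.monomial α r else 0 := by
  rw [faceRestrict, MvPolynomial.aeval_monomial]
  split_ifs with h
  · rw [MvPolynomial.monomial_eq, MvPolynomial.algebraMap_eq]
    congr 1
    refine Finset.prod_congr rfl fun i hi => ?_
    simp only [if_pos (h hi)]
  · obtain ⟨i, hi, his⟩ := Finset.not_subset.mp h
    rw [Finsupp.prod, Finset.prod_eq_zero hi, mul_zero]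
    rw [if_neg his, zero_pow (Finsupp.mem_support_iff.mp hi)]

theorem coeff_faceRestrict (s : Finset σ) (P : MvPolynomial σ ℝ) (α : σ →₀ ℕ) :
    (faceRestrict s P).coeff α = if α.support ⊆ s then P.coeff α else 0 := by
  induction P using MvPolynomial.induction_on' with
  | monomial β r =>
    rw [faceRestrict_monomial, MvPolynomial.coeff_monomial]
    by_cases h : β = α
    · subst h
      by_cases hs : β.support ⊆ s <;> simp [hs]
    · rw [if_neg h]; split_ifs <;> simp [MvPolynomial.coeff_monomial, h]
  | add p q hp hq =>
    rw [map_add, MvPolynomial.coeff_add, hp, hq]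
    split_ifs <;> simp

theorem faceRestrict_eq_zero_iff {s : Finset σ} {P : MvPolynomial σ ℝ} :
    faceRestrict s P = 0 ↔ ∀ α : σ →₀ ℕ, α.support ⊆ s → P.coeff α = 0 := by
  simp [MvPolynomial.ext_iff, coeff_faceRestrict]

theorem dirichlet_faceRestrict (s : Finset σ) (P : MvPolynomial σ ℝ) :
    dirichlet s (faceRestrict s P) = dirichlet s P := by
  induction P using MvPolynomial.induction_on' with
  | monomial β r =>
    rw [faceRestrict_monomial]
    split_ifs with h
    · rfl
    · simp [dirichlet_monomial, dirichletWeight, h]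
  | add p q hp hq => rw [map_add, map_add, map_add, hp, hq]

theorem dirichlet_mul_eq_zero {s : Finset σ} {P : MvPolynomial σ ℝ} (h : faceRestrict s P = 0)
    (Q : MvPolynomial σ ℝ) : dirichlet s (P * Q) = 0 := by
  rw [← dirichlet_faceRestrict, map_mul, h, zero_mul, map_zero]

/-- The point with barycentric coordinates `refBary t` at the vertices `j k`, and zero at the
other vertices. -/
def facePoint {d : ℕ} (j : Fin (d + 1) → σ) (t : Fin d → ℝ) (i : σ) : ℝ :=
  ∑ k, if j k = i then refBary t k else 0

theorem facePoint_apply {d : ℕ} {j : Fin (d + 1) → σ} (hj : Function.Injective j) (t : Fin d → ℝ)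
    (k : Fin (d + 1)) : facePoint j t (j k) = refBary t k := by
  simp [facePoint, hj.eq_iff]

theorem facePoint_of_notMem {d : ℕ} {j : Fin (d + 1) → σ} (t : Fin d → ℝ) {i : σ}
    (hi : i ∉ Finset.univ.image j) : facePoint j t i = 0 := by
  refine Finset.sum_eq_zero fun k _ => if_neg fun h => hi ?_
  exact Finset.mem_image.mpr ⟨k, Finset.mem_univ k, h⟩

theorem continuous_facePoint {d : ℕ} (j : Fin (d + 1) → σ) : Continuous (facePoint j) := by
  refine continuous_pi fun i => continuous_finsetSum _ fun k _ => ?_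
  split_ifs
  · exact (continuous_apply k).comp continuous_refBary
  · exact continuous_const

theorem continuous_eval_facePoint {d : ℕ} (j : Fin (d + 1) → σ) (P : MvPolynomial σ ℝ) :
    Continuous fun t => MvPolynomial.eval (facePoint j t) P :=
  (MvPolynomial.continuous_eval P).comp (continuous_facePoint j)

theorem dirichlet_image_eq_setIntegral {d : ℕ} {j : Fin (d + 1) → σ} (hj : Function.Injective j)
    (P : MvPolynomial σ ℝ) :
    dirichlet (Finset.univ.image j) P =
      ∫ t in refSimplex d, MvPolynomial.eval (facePoint j t) P := by
  have hint : ∀ P, IntegrableOn (fun t => MvPolynomial.eval (facePoint j t) P) (refSimplex d) :=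
    fun P => (continuous_eval_facePoint j P).continuousOn.integrableOn_compact
      (isCompact_refSimplex d)
  induction P using MvPolynomial.induction_on' with
  | monomial β r =>
    simp only [dirichlet_monomial, MvPolynomial.eval_monomial, integral_const_mul]
    congr 1
    rw [dirichletWeight]
    split_ifs with h
    · have h1 : ∀ t, (β.prod fun i e => facePoint j t i ^ e) = ∏ k, refBary t k ^ β (j k) := by
        intro t
        rw [Finsupp.prod_of_support_subset β h _ (by simp), Finset.prod_image hj.injOn]
        simp only [facePoint_apply hj]
      have h2 : β.degree = ∑ k, β (j k) := by
        rw [Finsupp.degree_apply, ← Finset.sum_image hj.injOn (f := fun i => β i)]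
        exact Finset.sum_subset h fun i _ hi => by simpa using hi
      simp_rw [h1, setIntegral_refSimplex_prod_pow]
      rw [Finset.prod_image hj.injOn, Finset.card_image_of_injective _ hj, Finset.card_fin, h2]
      rfl
    · obtain ⟨i, hi, his⟩ := Finset.not_subset.mp h
      have h1 : ∀ t, (β.prod fun i e => facePoint j t i ^ e) = 0 := by
        intro t
        refine Finset.prod_eq_zero hi ?_
        simp only
        rw [facePoint_of_notMem t his, zero_pow (Finsupp.mem_support_iff.mp hi)]
      simp [h1]
  | add p q hp hq =>
    simp only [map_add, hp, hq]
    exact (integral_add (hint p) (hint q)).symm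

/-- A homogeneous polynomial whose square has zero weighted integral over a simplex vanishes on
that simplex. -/
theorem faceRestrict_eq_zero_of_dirichlet_sq {s : Finset σ} (hs : s.Nonempty) {β : σ →₀ ℕ}
    (hβ : β.support ⊆ s) {R : MvPolynomial σ ℝ} {n : ℕ} (hR : R.IsHomogeneous n)
    (h : dirichlet s (MvPolynomial.monomial β 1 * R * R) = 0) : faceRestrict s R = 0 := by
  obtain ⟨d, hd⟩ := Nat.exists_eq_succ_of_ne_zero hs.card_ne_zero
  let e : Fin (d + 1) ≃ s := (s.equivFinOfCardEq hd).symm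
  set j : Fin (d + 1) → σ := fun k => e k with hjdef
  have hj : Function.Injective j := Subtype.val_injective.comp e.injective
  have hjs : Finset.univ.image j = s := by
    ext i
    simp only [Finset.mem_image, Finset.mem_univ, true_and, hjdef]
    exact ⟨fun ⟨k, hk⟩ => hk ▸ (e k).2, fun hi => ⟨e.symm ⟨i, hi⟩, by simp⟩⟩
  rw [← hjs, dirichlet_image_eq_setIntegral hj] at h
  have hnn : ∀ t ∈ refSimplex d, ∀ i, 0 ≤ facePoint j t i := by
    intro t ht i
    refine Finset.sum_nonneg fun k _ => ?_
    split_ifs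
    · refine Fin.cases ?_ (fun k => ?_) k
      · simpa [refBary] using ht.2
      · simpa [refBary] using ht.1 k
    · exact le_rfl
  rw [setIntegral_eq_zero_iff_of_nonneg_ae
    ((ae_restrict_iff' (isClosed_refSimplex d).measurableSet).mpr (Filter.Eventually.of_forall
      fun t ht => ?_)) ((continuous_eval_facePoint j _).continuousOn.integrableOn_compact
      (isCompact_refSimplex d))] at h
  swap
  · simp only [map_mul, MvPolynomial.eval_monomial, one_mul, mul_assoc, Pi.zero_apply]
    exact mul_nonneg (Finset.prod_nonneg fun i _ => pow_nonneg (hnn t ht i) _)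
      (mul_self_nonneg _)
  -- `R` vanishes on the interior of the simplex, where the weight is positive
  let U : Set (Fin d → ℝ) := {t | (∀ k, 0 < t k) ∧ ∑ k, t k < 1}
  have hU : IsOpen U := by
    have h1 : U = (⋂ k, {t | 0 < t k}) ∩ {t | ∑ k, t k < 1} := by ext t; simp [U]
    rw [h1]
    exact (isOpen_iInter_of_finite fun k => isOpen_lt continuous_const (continuous_apply k)).inter
      (isOpen_lt (by fun_prop) continuous_const)
  have hUsub : U ⊆ refSimplex d := fun t ht => ⟨fun k => (ht.1 k).le, ht.2.le⟩
  have hzero := Measure.eqOn_open_of_ae_eq (ae_restrict_of_ae_restrict_of_subset hUsub h) hU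
    (continuous_eval_facePoint j _).continuousOn continuousOn_const
  have hzero' : ∀ t ∈ U, MvPolynomial.eval (facePoint j t) R = 0 := by
    intro t ht
    have h1 := hzero ht
    simp only [map_mul, MvPolynomial.eval_monomial, one_mul, mul_assoc, Pi.zero_apply] at h1
    refine mul_self_eq_zero.mp ((mul_eq_zero.mp h1).resolve_left ?_)
    refine Finset.prod_ne_zero_iff.mpr fun i hi => pow_ne_zero _ (ne_of_gt ?_)
    obtain ⟨k, -, rfl⟩ := Finset.mem_image.mp (hjs ▸ hβ hi)
    rw [facePoint_apply hj]
    refine Fin.cases ?_ (fun k => ?_) k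
    · simpa [refBary] using ht.2
    · simpa [refBary] using ht.1 k
  -- by homogeneity, the restriction of `R` vanishes at all points with positive coordinates
  refine MvPolynomial.funext_set (fun _ => Set.Ioi (0 : ℝ)) (fun _ => Set.Ioi_infinite 0)
    fun x hx => ?_
  have hx0 : ∀ i, 0 < x i := fun i => hx i (Set.mem_univ i)
  set c := ∑ k, x (j k) with hc
  have hcpos : 0 < c := Finset.sum_pos (fun k _ => hx0 _) Finset.univ_nonempty
  have hx1 : (fun i => if i ∈ s then x i else 0) =
      c • facePoint j (fun k => x (j k.succ) / c) := by
    ext i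
    rw [Pi.smul_apply, smul_eq_mul]
    split_ifs with hi
    · obtain ⟨k, -, rfl⟩ := Finset.mem_image.mp (hjs.symm ▸ hi)
      rw [facePoint_apply hj]
      refine Fin.cases ?_ (fun k => ?_) k
      · rw [refBary, Fin.cons_zero, ← Finset.sum_div, mul_sub, mul_div_cancel₀ _ hcpos.ne', hc,
          Fin.sum_univ_succ]
        ring
      · rw [refBary, Fin.cons_succ, mul_div_cancel₀ _ hcpos.ne']
    · rw [facePoint_of_notMem _ (hjs.symm ▸ hi), mul_zero]
  have hev : MvPolynomial.eval x (faceRestrict s R) =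
      MvPolynomial.eval (fun i => if i ∈ s then x i else 0) R := by
    rw [faceRestrict, ← MvPolynomial.coe_aeval_eq_eval, ← MvPolynomial.coe_aeval_eq_eval]
    simp only [RingHom.coe_coe]
    rw [← AlgHom.comp_apply, MvPolynomial.comp_aeval]
    congr 2
    ext i
    split_ifs <;> simp
  rw [hev, hx1, eval_smul_of_isHomogeneous hR, hzero', mul_zero, map_zero]
  refine ⟨fun k => div_pos (hx0 _) hcpos, ?_⟩
  rw [← Finset.sum_div, div_lt_one hcpos, hc, Fin.sum_univ_succ]
  linarith [hx0 (j 0)]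

end Dirichlet

section Bubble

open scoped Nat
open MvPolynomial

variable {σ : Type*}

/-! ### Directional derivatives -/

/-- The derivative of a polynomial in barycentric coordinates in a direction along which the
coordinate `i` has the slope `c i`. -/
def dirDeriv (c : σ → ℝ) : Derivation ℝ (MvPolynomial σ ℝ) (MvPolynomial σ ℝ) :=
  mkDerivation ℝ fun i => C (c i)

theorem dirDeriv_X (c : σ → ℝ) (i : σ) : dirDeriv c (X i) = C (c i) := mkDerivation_X _ _ _

theorem dirDeriv_eq_sum [Fintype σ] (c : σ → ℝ) (P : MvPolynomial σ ℝ) :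
    dirDeriv c P = ∑ i, C (c i) * pderiv i P := by
  induction P using MvPolynomial.induction_on with
  | C a => simp [dirDeriv]
  | add p q hp hq => simp only [map_add, hp, hq, mul_add, Finset.sum_add_distrib]
  | mul_X p k hp =>
    rw [Derivation.leibniz, hp, dirDeriv_X]
    simp only [Derivation.leibniz, smul_eq_mul, mul_add, Finset.sum_add_distrib, Finset.mul_sum]
    congr 1
    · classical
      simp [pderiv_X, Pi.single_apply]
      ring
    · exact Finset.sum_congr rfl fun i _ => by ring

theorem isHomogeneous_divMonomial {P : MvPolynomial σ ℝ} {n k : ℕ} (hP : P.IsHomogeneous n)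
    (β : σ →₀ ℕ) (h : β.degree + k = n) : (divMonomial P β).IsHomogeneous k := by
  intro α hα
  rw [coeff_divMonomial] at hα
  have h1 : (β + α).degree = n := by_contra fun h1 => hα (hP.coeff_eq_zero h1)
  have h2 : α.degree = k := by rw [map_add] at h1; omega
  rw [← h2, Finsupp.degree_eq_weight_one]
  rfl

theorem pderiv_eq_zero_or_isHomogeneous {P : MvPolynomial σ ℝ} {n : ℕ} (hP : P.IsHomogeneous n)
    (i : σ) : pderiv i P = 0 ∨ ∃ k, k + 1 = n ∧ (pderiv i P).IsHomogeneous k := by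
  rcases n with _ | n
  · left
    rw [← totalDegree_zero_iff_isHomogeneous, totalDegree_eq_zero_iff_eq_C] at hP
    rw [hP, pderiv_C]
  · exact Or.inr ⟨n, rfl, hP.pderiv⟩

theorem prod_X_eq_monomial (s : Finset σ) :
    ∏ i ∈ s, (X i : MvPolynomial σ ℝ) = monomial (∑ i ∈ s, Finsupp.single i 1) 1 := by
  rw [monomial_sum_one]; rfl

variable [DecidableEq σ]

theorem support_sum_single_subset (s : Finset σ) :
    (∑ i ∈ s, Finsupp.single i 1 : σ →₀ ℕ).support ⊆ s := by
  intro k hk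
  by_contra hks
  refine Finsupp.mem_support_iff.mp hk ?_
  rw [Finsupp.finsetSum_apply]
  exact Finset.sum_eq_zero fun i hi => Finsupp.single_eq_of_ne fun h => hks (h ▸ hi)

/-! ### Integration by parts on a face -/

theorem dirichletWeight_single_add {s : Finset σ} {i : σ} (hi : i ∈ s) (α : σ →₀ ℕ) :
    dirichletWeight s (Finsupp.single i 1 + α) =
      (α i + 1) / (α.degree + s.card) * dirichletWeight s α := by
  have hsupp : (Finsupp.single i 1 + α).support ⊆ s ↔ α.support ⊆ s := by
    simp only [Finset.subset_iff, Finsupp.mem_support_iff, Finsupp.add_apply]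
    refine forall_congr' fun k => ?_
    by_cases hk : k = i
    · subst hk; simp [hi]
    · simp [Ne.symm hk]
  have hc : 0 < s.card := Finset.card_pos.mpr ⟨i, hi⟩
  rw [dirichletWeight, dirichletWeight]
  by_cases h : α.support ⊆ s
  · rw [if_pos h, if_pos (hsupp.mpr h), ← Finset.mul_prod_erase s _ hi,
      ← Finset.mul_prod_erase s _ hi]
    have h1 : ∏ k ∈ s.erase i, (((Finsupp.single i 1 + α : σ →₀ ℕ) k)! : ℝ) =
        ∏ k ∈ s.erase i, ((α k)! : ℝ) := by
      refine Finset.prod_congr rfl fun k hk => ?_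
      rw [Finsupp.add_apply, Finsupp.single_eq_of_ne (Finset.ne_of_mem_erase hk), zero_add]
    have h2 : (Finsupp.single i 1 + α).degree + s.card - 1 = (α.degree + s.card - 1) + 1 := by
      rw [map_add, Finsupp.degree_single]; omega
    have h3 : ((α.degree + s.card - 1 : ℕ) : ℝ) + 1 = α.degree + s.card := by
      exact_mod_cast (by omega : α.degree + s.card - 1 + 1 = α.degree + s.card)
    rw [h1, h2, Finsupp.add_apply, Finsupp.single_eq_same, add_comm 1 (α i), Nat.factorial_succ,
      Nat.factorial_succ]
    push_cast
    rw [h3]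
    have h4 : (α.degree + s.card : ℝ) ≠ 0 := by positivity
    field_simp
  · rw [if_neg h, if_neg (fun h' => h (hsupp.mp h')), mul_zero]

theorem dirichlet_X_mul_monomial {s : Finset σ} {i : σ} (hi : i ∈ s) (α : σ →₀ ℕ) (r : ℝ) :
    dirichlet s (X i * monomial α r) =
      (α i + 1) / (α.degree + s.card) * dirichlet s (monomial α r) := by
  rw [X, monomial_mul, one_mul, dirichlet_monomial, dirichlet_monomial,
    dirichletWeight_single_add hi]
  ring

/-- On the simplex `s`, the derivatives with respect to `λ_i` and `λ_j` of a polynomial that is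
divisible by `λ_i λ_j` have the same integral: their difference is the derivative in the direction
of the edge joining `i` and `j`, and the boundary terms vanish. -/
theorem dirichlet_pderiv_comm {s : Finset σ} {i j : σ} (hij : i ≠ j) (hi : i ∈ s) (hj : j ∈ s)
    (R : MvPolynomial σ ℝ) :
    dirichlet s (pderiv i (X i * X j * R)) = dirichlet s (pderiv j (X i * X j * R)) := by
  have key : ∀ {i j : σ}, i ≠ j → i ∈ s → j ∈ s → ∀ (α : σ →₀ ℕ) (r : ℝ),
      dirichlet s (pderiv i (X i * X j * monomial α r)) = (α i + 1) * ((α j + 1) /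
        (α.degree + s.card) * dirichlet s (monomial α r)) := by
    intro i j hij hi hj α r
    have h : pderiv i (X i * X j * monomial α r) = (α i + 1 : ℝ) • (X j * monomial α r) := by
      simp only [X, monomial_mul, one_mul, pderiv_monomial, smul_monomial]
      rw [add_assoc, add_tsub_cancel_left]
      simp [Finsupp.single_eq_of_ne hij]
      ring_nf
    rw [h, map_smul, dirichlet_X_mul_monomial hj, smul_eq_mul]
  induction R using MvPolynomial.induction_on' with
  | monomial α r =>
    rw [key hij hi hj, mul_comm (X i) (X j), key hij.symm hj hi]
    ring
  | add p q hp hq => simp only [mul_add, map_add, hp, hq]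

theorem exists_eq_X_mul [Fintype σ] {m : σ} {P : MvPolynomial σ ℝ} {n : ℕ}
    (hP : P.IsHomogeneous n) (h : faceRestrict {m}ᶜ P = 0) :
    P = 0 ∨ ∃ k R, k + 1 = n ∧ R.IsHomogeneous k ∧ P = X m * R := by
  rw [faceRestrict_eq_zero_iff] at h
  have hmod : modMonomial P (Finsupp.single m 1) = 0 := by
    ext α
    rw [coeff_zero]
    by_cases hα : Finsupp.single m 1 ≤ α
    · rw [coeff_modMonomial_of_le _ hα]
    · rw [coeff_modMonomial_of_not_le _ hα]
      refine h α fun i hi => ?_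
      rw [Finset.mem_compl, Finset.mem_singleton]
      rintro rfl
      exact hα (Finsupp.single_le_iff.mpr (Nat.one_le_iff_ne_zero.mpr
        (Finsupp.mem_support_iff.mp hi)))
  have hdiv := divMonomial_add_modMonomial_single P m
  rw [hmod, add_zero] at hdiv
  rcases n with _ | n
  · left
    ext α
    rw [coeff_zero]
    by_cases hα : α = 0
    · subst hα; exact h 0 (by simp)
    · exact hP.coeff_eq_zero fun h0 => hα ((Finsupp.degree_eq_zero_iff α).mp h0)
  · exact Or.inr ⟨n, _, rfl, isHomogeneous_divMonomial hP _ (by simp [add_comm]), hdiv.symm⟩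

/-! ### The normal derivative bubbles -/

variable [Fintype σ]

/-- The bubble polynomial of the face opposite to the vertex `m`. -/
def bubblePoly (m : σ) : MvPolynomial σ ℝ := ∏ i ∈ {m}ᶜ, X i

theorem bubblePoly_eq_monomial (m : σ) : (bubblePoly m : MvPolynomial σ ℝ) =
    monomial (∑ i ∈ {m}ᶜ, Finsupp.single i 1) 1 := prod_X_eq_monomial _

theorem pderiv_bubblePoly_self (m : σ) : pderiv m (bubblePoly m : MvPolynomial σ ℝ) = 0 := by
  rw [bubblePoly_eq_monomial, pderiv_monomial]
  have := support_sum_single_subset ({m}ᶜ : Finset σ)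
  rw [Finsupp.notMem_support_iff.mp fun h => by simpa using this h]
  simp

/-- If `b_F² P`, with `P` orthogonal to lower degree on `F` for the weight `b_F²`, has a normal
derivative on `F` that is orthogonal to `P`, then `P` vanishes on `F`. Integration by parts turns
the normal direction into the direction from the opposite vertex to the centroid of `F`, in which
`b_F²` is increasing. -/
theorem faceRestrict_eq_zero_of_bubble {m : σ} (hF : ({m}ᶜ : Finset σ).Nonempty) {c : σ → ℝ}
    (hc : ∑ i, c i = 0) (hcm : c m ≠ 0) {P : MvPolynomial σ ℝ} {n : ℕ} (hP : P.IsHomogeneous n)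
    (h1 : ∀ Q k, Q.IsHomogeneous k → k + 1 ≤ n →
      dirichlet {m}ᶜ (bubblePoly m ^ 2 * P * Q) = 0)
    (h2 : dirichlet {m}ᶜ (dirDeriv c (bubblePoly m ^ 2 * P) * P) = 0) :
    faceRestrict {m}ᶜ P = 0 := by
  set F : Finset σ := {m}ᶜ with hFdef
  set b : MvPolynomial σ ℝ := bubblePoly m with hb
  -- `∂_i P` has lower degree, so that derivatives of the factor `P` do not contribute
  have horth : ∀ i, dirichlet F (b ^ 2 * P * pderiv i P) = 0 := by
    intro i
    rcases pderiv_eq_zero_or_isHomogeneous hP i with h | ⟨k, hk, hk'⟩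
    · rw [h, mul_zero, map_zero]
    · exact h1 _ k hk' hk.le
  have e1 : ∀ i, dirichlet F (pderiv i (b ^ 2 * P) * P) =
      dirichlet F (pderiv i (b ^ 2) * P * P) := by
    intro i
    have : pderiv i (b ^ 2 * P) * P = pderiv i (b ^ 2) * P * P + b ^ 2 * P * pderiv i P := by
      rw [Derivation.leibniz]; simp only [smul_eq_mul]; ring
    rw [this, map_add, horth, add_zero]
  have e2 : ∀ i, dirichlet F (pderiv i (b ^ 2 * P * P)) =
      dirichlet F (pderiv i (b ^ 2) * P * P) := by
    intro i
    have : pderiv i (b ^ 2 * P * P) = pderiv i (b ^ 2) * P * P +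
        (2 : ℝ) • (b ^ 2 * P * pderiv i P) := by
      rw [Derivation.leibniz, Derivation.leibniz, two_smul]; simp only [smul_eq_mul]; ring
    rw [this, map_add, map_smul, horth, smul_zero, add_zero]
  obtain ⟨k, hk⟩ := hF
  have hfac : ∀ i ∈ F, b = X i * ∏ j ∈ F.erase i, X j := fun i hi =>
    (Finset.mul_prod_erase F X hi).symm
  have e3 : ∀ i ∈ F, dirichlet F (pderiv i (b ^ 2 * P * P)) =
      dirichlet F (pderiv k (b ^ 2 * P * P)) := by
    intro i hi
    by_cases hik : i = k
    · rw [hik]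
    have h3 : b = X i * (X k * ∏ j ∈ (F.erase i).erase k, X j) := by
      rw [hfac i hi, Finset.mul_prod_erase (F.erase i) X
        (Finset.mem_erase.mpr ⟨Ne.symm hik, hk⟩)]
    have h4 : b ^ 2 * P * P = X i * X k * ((∏ j ∈ (F.erase i).erase k, X j) * b * P * P) := by
      rw [pow_two]; nth_rewrite 1 [h3]; ring
    rw [h4, dirichlet_pderiv_comm hik hi hk]
  -- by `e3` and `∑ c i = 0`, the hypothesis `h2` says that this integral times `-c m` is zero
  have e4 : dirichlet F (pderiv k (b ^ 2 * P * P)) = 0 := by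
    rw [dirDeriv_eq_sum, Finset.sum_mul, map_sum] at h2
    simp only [C_mul', smul_mul_assoc, map_smul, smul_eq_mul, e1, ← e2] at h2
    rw [← Finset.sum_compl_add_sum {m}, Finset.sum_singleton, e2 m,
      Derivation.leibniz_pow, pderiv_bubblePoly_self,
      Finset.sum_congr rfl fun i hi => by rw [e3 i hi], ← Finset.sum_mul] at h2
    rw [← Finset.sum_compl_add_sum {m}, Finset.sum_singleton] at hc
    simp only [smul_zero, zero_mul, map_zero, mul_zero, add_zero] at h2
    refine (mul_eq_zero.mp h2).resolve_left fun h => hcm ?_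
    rw [h, zero_add] at hc
    exact hc
  rw [e2] at e4
  -- the weight `∂_k (b²)` is twice a monomial on `F`, hence nonnegative
  have h5 : pderiv k (b ^ 2) =
      (2 : ℝ) • monomial (∑ i ∈ F, Finsupp.single i 1 + ∑ i ∈ F.erase k, Finsupp.single i 1) 1 := by
    have h6 : pderiv k b = ∏ j ∈ F.erase k, X j := by
      rw [hfac k hk, Derivation.leibniz, pderiv_X_self, prod_X_eq_monomial, pderiv_monomial,
        Finsupp.notMem_support_iff.mp fun h => by
          simpa using support_sum_single_subset (F.erase k) h]
      simp
    rw [Derivation.leibniz_pow, h6, ← one_mul (1 : ℝ), ← monomial_mul, ← prod_X_eq_monomial,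
      ← prod_X_eq_monomial]
    simp [two_smul, hb, bubblePoly, hFdef]
  rw [h5, smul_mul_assoc, smul_mul_assoc, map_smul, smul_eq_mul] at e4
  refine faceRestrict_eq_zero_of_dirichlet_sq ⟨k, hk⟩ (fun i hi => ?_) hP
    ((mul_eq_zero.mp e4).resolve_left two_ne_zero)
  rcases Finset.mem_union.mp (Finsupp.support_add hi) with h | h
  · exact support_sum_single_subset _ h
  · exact Finset.mem_of_mem_erase (support_sum_single_subset _ h)

/-- A function `b_F² P`, with `P` of degree `n`, is determined by its moments of order `n - 1` on
the face `F`, its moments of order `n - 2` on the whole simplex, and the moments of order `n` of its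
normal derivative on `F`. -/
theorem eq_zero_of_bubble_moments {m : σ} (hF : ({m}ᶜ : Finset σ).Nonempty) {c : σ → ℝ}
    (hc : ∑ i, c i = 0) (hcm : c m ≠ 0) {P : MvPolynomial σ ℝ} {n : ℕ} (hP : P.IsHomogeneous n)
    (h1 : ∀ Q k, Q.IsHomogeneous k → k + 1 ≤ n →
      dirichlet {m}ᶜ (bubblePoly m ^ 2 * P * Q) = 0)
    (h2 : ∀ Q k, Q.IsHomogeneous k → k + 2 ≤ n →
      dirichlet Finset.univ (bubblePoly m ^ 2 * P * Q) = 0)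
    (h3 : ∀ Q k, Q.IsHomogeneous k → k ≤ n →
      dirichlet {m}ᶜ (dirDeriv c (bubblePoly m ^ 2 * P) * Q) = 0) :
    P = 0 := by
  have hsq : (bubblePoly m : MvPolynomial σ ℝ) ^ 2 =
      monomial (2 • ∑ i ∈ {m}ᶜ, Finsupp.single i 1) 1 := by
    rw [bubblePoly_eq_monomial, monomial_pow, one_pow]
  have hsupp : (2 • ∑ i ∈ {m}ᶜ, Finsupp.single i 1 : σ →₀ ℕ).support ⊆ {m}ᶜ :=
    Finsupp.support_smul.trans (support_sum_single_subset _)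
  have hX : faceRestrict {m}ᶜ (X m : MvPolynomial σ ℝ) = 0 := by simp [faceRestrict_X]
  rcases exists_eq_X_mul hP (faceRestrict_eq_zero_of_bubble hF hc hcm hP h1 (h3 P n hP le_rfl))
    with h | ⟨k, R, hk, hR, rfl⟩
  · exact h
  -- `∂_n (b² λ_m R) = c m b² R` on the face, since `λ_m = 0` there
  have h4 : dirichlet {m}ᶜ (bubblePoly m ^ 2 * R * R) = 0 := by
    have h5 : dirDeriv c (bubblePoly m ^ 2 * (X m * R)) * R =
        C (c m) * (bubblePoly m ^ 2 * R * R) + X m * (dirDeriv c (bubblePoly m ^ 2 * R) * R) := by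
      rw [mul_left_comm, Derivation.leibniz, dirDeriv_X]
      simp only [smul_eq_mul]
      ring
    have h6 := h3 R k hR (by omega)
    rw [h5, map_add, dirichlet_mul_eq_zero hX, add_zero, C_mul', map_smul, smul_eq_mul] at h6
    exact (mul_eq_zero.mp h6).resolve_left hcm
  rw [hsq] at h4
  rcases exists_eq_X_mul hR (faceRestrict_eq_zero_of_dirichlet_sq hF hsupp hR h4)
    with h | ⟨l, S, hl, hS, rfl⟩
  · rw [h, mul_zero]
  have h7 := h2 S l hS (by omega)
  rw [hsq, ← mul_assoc (X m), ← pow_two, X_pow_eq_monomial, ← mul_assoc, monomial_mul,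
    one_mul] at h7
  have h8 := faceRestrict_eq_zero_of_dirichlet_sq ⟨m, Finset.mem_univ m⟩ (Finset.subset_univ _)
    hS h7
  have h9 : S = 0 := by
    ext α
    exact faceRestrict_eq_zero_iff.mp h8 α (Finset.subset_univ _)
  rw [h9, mul_zero, mul_zero]

end Bubble

section Core

open scoped Nat
open MvPolynomial

/-! ### Rodrigues' formula -/

/-- The coefficients of the derivative of order `n` of `s ^ (n + 1) * (1 - s) ^ n`, up to a
constant factor. -/
def rodriguesCoeff (n j : ℕ) : ℝ :=
  (-1) ^ (n - j) * n.choose j / ((n + 1 - j)! * j !)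

theorem rodriguesCoeff_ne_zero {n j : ℕ} (hj : j ≤ n) : rodriguesCoeff n j ≠ 0 := by
  have : (n.choose j : ℝ) ≠ 0 := by exact_mod_cast (Nat.choose_pos hj).ne'
  rw [rodriguesCoeff]
  refine div_ne_zero (mul_ne_zero ?_ this) (by positivity)
  exact pow_ne_zero _ (by norm_num)

/-- Orthogonality of the Rodrigues polynomial to lower degree: a finite difference of order `n` of
a polynomial of degree less than `n`. -/
theorem sum_rodriguesCoeff_mul (n a b : ℕ) (h : a + b < n) :
    ∑ j ∈ Finset.range (n + 1), rodriguesCoeff n j * ((n + 1 - j + a)! * (j + b)!) = 0 := by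
  -- `p j` is the quotient of `(n + 1 - j + a)! (j + b)!` by `(n + 1 - j)! j!`
  let p : Polynomial ℝ := (ascPochhammer ℝ a).comp (Polynomial.C (n + 2 : ℝ) - Polynomial.X) *
    (ascPochhammer ℝ b).comp (Polynomial.X + 1)
  have hp : p.natDegree < n := by
    refine lt_of_le_of_lt Polynomial.natDegree_mul_le ?_
    rw [Polynomial.natDegree_comp, Polynomial.natDegree_comp, ascPochhammer_natDegree,
      ascPochhammer_natDegree]
    have h1 : (Polynomial.C (n + 2 : ℝ) - Polynomial.X).natDegree ≤ 1 := by compute_degree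
    have h2 : (Polynomial.X + 1 : Polynomial ℝ).natDegree ≤ 1 := by compute_degree
    nlinarith
  have h0 := congrFun (Polynomial.fwdDiff_iter_eq_zero_of_degree_lt hp) 0
  rw [fwdDiff_iter_eq_sum_shift] at h0
  refine Eq.trans (Finset.sum_congr rfl fun j hj => ?_) h0
  have hj' : j ≤ n := by have := Finset.mem_range.mp hj; omega
  have e1 : p.eval (0 + j • (1 : ℝ)) =
      ((n + 1 - j + a)! : ℝ) / (n + 1 - j)! * (((j + b)! : ℝ) / j !) := by
    have e2 : (n + 2 : ℝ) - j = ((n + 1 - j + 1 : ℕ) : ℝ) := by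
      rw [Nat.cast_add, Nat.cast_sub (by omega)]; push_cast; ring
    have e3 : (j : ℝ) + 1 = ((j + 1 : ℕ) : ℝ) := by push_cast; ring
    have f : ∀ x k : ℕ, (ascPochhammer ℝ k).eval ((x + 1 : ℕ) : ℝ) = ((x + k)! : ℝ) / x ! := by
      intro x k
      rw [← ascPochhammer_eval_cast, ascPochhammer_nat_eq_ascFactorial, eq_div_iff (by positivity)]
      rw [mul_comm]
      exact_mod_cast Nat.factorial_mul_ascFactorial x k
    simp only [p, Polynomial.eval_mul, Polynomial.eval_comp, Polynomial.eval_sub,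
      Polynomial.eval_C, Polynomial.eval_X, Polynomial.eval_add, Polynomial.eval_one, zero_add,
      nsmul_eq_mul, mul_one]
    rw [e2, e3, f, f]
  rw [e1, rodriguesCoeff, zsmul_eq_mul]
  push_cast
  field_simp

/-! ### Vanishing of Bernstein coefficients -/

variable {σ : Type*} [DecidableEq σ]

/-- A homogeneous polynomial that vanishes on all proper faces of the simplex `s` and is
orthogonal on `s` to the polynomials of complementary degree vanishes on `s`. -/
theorem faceRestrict_eq_zero_of_moments {s : Finset σ} (hs : s.Nonempty) {P : MvPolynomial σ ℝ}
    {n : ℕ} (hP : P.IsHomogeneous n)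
    (h0 : ∀ t ⊂ s, t.Nonempty → faceRestrict t P = 0) (hn : n ≠ 0)
    (h1 : ∀ Q k, Q.IsHomogeneous k → k + s.card ≤ n → dirichlet s (P * Q) = 0) :
    faceRestrict s P = 0 := by
  set β : σ →₀ ℕ := ∑ i ∈ s, Finsupp.single i 1 with hβ
  have hβ1 : ∀ i ∈ s, β i = 1 := by
    intro i hi
    rw [hβ, Finsupp.finsetSum_apply, Finset.sum_eq_single_of_mem i hi]
    · simp
    · exact fun j _ hji => Finsupp.single_eq_of_ne hji.symm
  have hβs : β.support ⊆ s := support_sum_single_subset s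
  have hβd : β.degree = s.card := by simp [hβ, map_sum]
  -- a monomial on `s` that is not divisible by the bubble lives on a proper face
  have hmod : faceRestrict s (modMonomial P β) = 0 := by
    rw [faceRestrict_eq_zero_iff]
    intro α hα
    by_cases hle : β ≤ α
    · exact coeff_modMonomial_of_le _ hle
    rw [coeff_modMonomial_of_not_le _ hle]
    obtain ⟨i, hi⟩ : ∃ i, ¬ β i ≤ α i := by
      by_contra! h; exact hle h
    have his : i ∈ s := by
      by_contra h
      exact hi ((Finsupp.notMem_support_iff.mp fun h' => h (hβs h')).trans_le (Nat.zero_le _))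
    have hiα : i ∉ α.support := by
      rw [Finsupp.notMem_support_iff]
      have := hβ1 i his
      omega
    by_cases hα0 : α = 0
    · refine hP.coeff_eq_zero ?_
      rw [hα0, map_zero]; exact hn.symm
    · refine faceRestrict_eq_zero_iff.mp (h0 α.support ⟨hα, fun h => hiα (h his)⟩ ?_) α subset_rfl
      exact Finsupp.support_nonempty_iff.mpr hα0
  have hdiv : monomial β 1 * divMonomial P β + modMonomial P β = P :=
    divMonomial_add_modMonomial P β
  have hD : ∀ Q, dirichlet s (P * Q) = dirichlet s (monomial β 1 * divMonomial P β * Q) := by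
    intro Q
    conv_lhs => rw [← hdiv, add_mul, map_add, dirichlet_mul_eq_zero hmod, add_zero]
  have hR : faceRestrict s (divMonomial P β) = 0 := by
    by_cases hcard : s.card ≤ n
    · have hh : (divMonomial P β).IsHomogeneous (n - s.card) :=
        isHomogeneous_divMonomial hP β (by omega)
      refine faceRestrict_eq_zero_of_dirichlet_sq hs hβs hh ?_
      rw [← hD]
      exact h1 _ _ hh (by omega)
    · have : divMonomial P β = 0 := by
        ext α
        rw [coeff_divMonomial, coeff_zero]
        refine hP.coeff_eq_zero ?_
        rw [map_add]; omega
      rw [this, map_zero]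
  rw [← hdiv, map_add, map_mul, hR, hmod, mul_zero, add_zero]

theorem faceRestrict_singleton_of_isHomogeneous {P : MvPolynomial σ ℝ} {n : ℕ}
    (hP : P.IsHomogeneous n) (m : σ) :
    faceRestrict {m} P = C (P.coeff (Finsupp.single m n)) * X m ^ n := by
  ext α
  rw [coeff_faceRestrict, X_pow_eq_monomial, C_mul_monomial, mul_one, coeff_monomial]
  by_cases h : α.support ⊆ {m}
  · obtain ⟨b, rfl⟩ := Finsupp.support_subset_singleton'.mp h
    by_cases hb : b = n
    · subst hb; simp [h]
    · rw [if_pos h, if_neg fun h' => hb (Finsupp.single_injective m h').symm,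
        hP.coeff_eq_zero (by simpa using hb)]
  · rw [if_neg h, if_neg]
    rintro rfl
    exact h Finsupp.support_single_subset

/-! ### Integrals of polynomials in one barycentric coordinate -/

theorem dirichlet_sum_X_mul {s : Finset σ} (hs : s.Nonempty) (P : MvPolynomial σ ℝ) :
    dirichlet s ((∑ i ∈ s, X i) * P) = dirichlet s P := by
  induction P using MvPolynomial.induction_on' with
  | monomial α r =>
    rw [Finset.sum_mul, map_sum, Finset.sum_congr rfl fun i hi => dirichlet_X_mul_monomial hi α r,
      ← Finset.sum_mul, ← Finset.sum_div]
    by_cases h : α.support ⊆ s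
    · have h1 : ∑ i ∈ s, ((α i : ℝ) + 1) = α.degree + s.card := by
        rw [Finset.sum_add_distrib, Finsupp.degree_apply]
        simp only [Finset.sum_const, nsmul_eq_mul, mul_one, Nat.cast_sum]
        congr 1
        exact (Finset.sum_subset h fun i _ hi => by simpa using hi).symm
      have h2 : (α.degree + s.card : ℝ) ≠ 0 := by
        have : (0 : ℝ) < s.card := by exact_mod_cast hs.card_pos
        positivity
      rw [h1, div_self h2, one_mul]
    · rw [dirichlet_monomial, dirichletWeight, if_neg h, mul_zero, mul_zero]
  | add p q hp hq => rw [mul_add, map_add, map_add, hp, hq]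

theorem dirichlet_one_ne_zero (s : Finset σ) : dirichlet s (1 : MvPolynomial σ ℝ) ≠ 0 := by
  have : (1 : MvPolynomial σ ℝ) = monomial 0 1 := rfl
  rw [this, dirichlet_monomial, dirichletWeight, if_pos (by simp), one_mul]
  simp only [Finsupp.coe_zero, Pi.zero_apply, Nat.factorial_zero, Nat.cast_one,
    Finset.prod_const_one]
  positivity

variable [Fintype σ]

/-- The sum of the barycentric coordinates other than `m`. -/
def coSum (m : σ) : MvPolynomial σ ℝ := ∑ i ∈ {m}ᶜ, X i

theorem isHomogeneous_coSum (m : σ) : (coSum m).IsHomogeneous 1 :=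
  IsHomogeneous.sum _ _ _ fun i _ => isHomogeneous_X ℝ i

theorem dirichlet_coSum_pow_ne_zero {m : σ} (hF : ({m}ᶜ : Finset σ).Nonempty) (q : ℕ) :
    dirichlet {m}ᶜ (coSum m ^ q) ≠ 0 := by
  induction q with
  | zero => rw [pow_zero]; exact dirichlet_one_ne_zero _
  | succ q ih => rwa [pow_succ', coSum, dirichlet_sum_X_mul hF]

/-- The slices of the simplex `s` parallel to the facet opposite to `m` reduce integrals of
functions of the coordinate `m` to beta integrals. -/
theorem dirichlet_X_pow_mul_coSum_pow {s : Finset σ} {m : σ} (hm : m ∈ s) (p q r : ℕ)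
    (α : σ →₀ ℕ) (hα : α.support ⊆ s) (hr : r + α m + 2 = α.degree + s.card) :
    dirichlet s (X m ^ p * coSum m ^ q * monomial α 1) =
      ((p + α m)! * (q + r)! : ℝ) / (p + q + α.degree + s.card - 1)! *
        ((∏ i ∈ s.erase m, ((α i)! : ℝ)) / r !) := by
  induction q generalizing α r with
  | zero =>
    rw [pow_zero, mul_one, X_pow_eq_monomial, monomial_mul, one_mul, dirichlet_monomial, one_mul,
      dirichletWeight, if_pos, ← Finset.mul_prod_erase s _ hm, map_add, Finsupp.degree_single,
      Finsupp.add_apply, Finsupp.single_eq_same, add_zero, zero_add]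
    · have h1 : ∏ k ∈ s.erase m, (((Finsupp.single m p + α : σ →₀ ℕ) k)! : ℝ) =
          ∏ k ∈ s.erase m, ((α k)! : ℝ) := by
        refine Finset.prod_congr rfl fun k hk => ?_
        rw [Finsupp.add_apply, Finsupp.single_eq_of_ne (Finset.ne_of_mem_erase hk), zero_add]
      rw [h1]
      have : (r ! : ℝ) ≠ 0 := by positivity
      field_simp
    · refine Finsupp.support_add.trans (Finset.union_subset ?_ hα)
      exact Finsupp.support_single_subset.trans (Finset.singleton_subset_iff.mpr hm)
  | succ q ih =>
    have h1 : X m ^ p * coSum m ^ (q + 1) * monomial α (1 : ℝ) =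
        ∑ i ∈ {m}ᶜ, X m ^ p * coSum m ^ q * monomial (Finsupp.single i 1 + α) 1 := by
      rw [← Finset.mul_sum, pow_succ, mul_assoc, mul_assoc, mul_assoc]
      congr 2
      rw [coSum, Finset.sum_mul]
      exact Finset.sum_congr rfl fun i _ => by rw [X, monomial_mul, one_mul]
    have h2 : ∀ i ∈ ({m}ᶜ : Finset σ), i ∉ s.erase m →
        dirichlet s (X m ^ p * coSum m ^ q * monomial (Finsupp.single i 1 + α) 1) = 0 := by
      intro i hi his
      have hi' : i ∉ s := fun h => his (Finset.mem_erase.mpr ⟨by simpa using hi, h⟩)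
      rw [mul_comm]
      refine dirichlet_mul_eq_zero ?_ _
      rw [faceRestrict_monomial, if_neg]
      intro h
      exact hi' (h (by simp))
    have hsub : s.erase m ⊆ {m}ᶜ := fun i hi => by simpa using Finset.ne_of_mem_erase hi
    have h3 : ∀ i ∈ s.erase m,
        dirichlet s (X m ^ p * coSum m ^ q * monomial (Finsupp.single i 1 + α) 1) =
          ((α i : ℝ) + 1) * (((p + α m)! * (q + (r + 1))! : ℝ) /
            (p + q + (α.degree + 1) + s.card - 1)! *
              ((∏ i ∈ s.erase m, ((α i)! : ℝ)) / (r + 1)!)) := by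
      intro i hi
      obtain ⟨him, his⟩ := Finset.mem_erase.mp hi
      have e1 : (Finsupp.single i 1 + α : σ →₀ ℕ) m = α m := by
        rw [Finsupp.add_apply, Finsupp.single_eq_of_ne him.symm, zero_add]
      have e2 : (Finsupp.single i 1 + α : σ →₀ ℕ).degree = α.degree + 1 := by
        rw [map_add, Finsupp.degree_single, add_comm]
      rw [ih (r + 1) _ (Finsupp.support_add.trans (Finset.union_subset
        (Finsupp.support_single_subset.trans (Finset.singleton_subset_iff.mpr his)) hα))
        (by rw [e1, e2]; omega), e1, e2, ← Finset.mul_prod_erase _ _ hi,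
        ← Finset.mul_prod_erase _ _ hi]
      have e3 : ∏ k ∈ (s.erase m).erase i, (((Finsupp.single i 1 + α : σ →₀ ℕ) k)! : ℝ) =
          ∏ k ∈ (s.erase m).erase i, ((α k)! : ℝ) := by
        refine Finset.prod_congr rfl fun k hk => ?_
        rw [Finsupp.add_apply, Finsupp.single_eq_of_ne (Finset.ne_of_mem_erase hk), zero_add]
      rw [e3, Finsupp.add_apply, Finsupp.single_eq_same, add_comm 1 (α i), Nat.factorial_succ]
      push_cast
      ring
    have h4 : ∑ i ∈ s.erase m, ((α i : ℝ) + 1) = r + 1 := by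
      have e1 : ∑ i ∈ s, (α i + 1) = α.degree + s.card := by
        rw [Finset.sum_add_distrib, Finsupp.degree_apply]
        simp only [Finset.sum_const, smul_eq_mul, mul_one]
        congr 1
        exact (Finset.sum_subset hα fun i _ hi => by simpa using hi).symm
      rw [← Finset.add_sum_erase _ _ hm] at e1
      have e2 : ∑ i ∈ s.erase m, (α i + 1) = r + 1 := by omega
      exact_mod_cast e2
    rw [h1, map_sum, ← Finset.sum_subset hsub h2, Finset.sum_congr rfl h3, ← Finset.sum_mul, h4,
      Nat.factorial_succ r]
    have e1 : p + q + (α.degree + 1) + s.card - 1 = p + (q + 1) + α.degree + s.card - 1 := by omega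
    have e2 : q + (r + 1) = q + 1 + r := by omega
    have e3 : (r ! : ℝ) ≠ 0 := by positivity
    have e4 : ((r : ℝ) + 1) ≠ 0 := by positivity
    rw [e1, e2]
    push_cast
    field_simp

/-! ### The shape functions that remain at the vertices -/

/-- A function of the barycentric coordinate `m` only: the derivative of order `n` of
`s ^ (n + 1) * (1 - s) ^ n` at `s = λ_m`, up to a constant factor, made homogeneous of degree
`n + 1` by writing `coSum m` for `1 - s`. -/
def rodriguesPoly (n : ℕ) (m : σ) : MvPolynomial σ ℝ :=
  ∑ j ∈ Finset.range (n + 1), C (rodriguesCoeff n j) * (X m ^ (n + 1 - j) * coSum m ^ j)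

theorem isHomogeneous_rodriguesPoly (n : ℕ) (m : σ) :
    (rodriguesPoly n m).IsHomogeneous (n + 1) := by
  refine IsHomogeneous.sum _ _ _ fun j hj => IsHomogeneous.C_mul ?_ _
  have h := ((isHomogeneous_X ℝ m).pow (n + 1 - j)).mul ((isHomogeneous_coSum m).pow j)
  convert h using 1
  have := Finset.mem_range.mp hj
  omega

/-- `rodriguesPoly n m` is orthogonal to the test polynomials on all edges and faces and on the
tetrahedron: slicing `s` parallel to the facet opposite to `m` gives the integral of the Rodrigues
polynomial against `λ_m ^ a * (1 - λ_m) ^ b` with `a + b < n`. -/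
theorem dirichlet_rodriguesPoly_mul {n : ℕ} {m : σ} {s : Finset σ} (hs : 2 ≤ s.card)
    {Q : MvPolynomial σ ℝ} {k : ℕ} (hQ : Q.IsHomogeneous k) (hk : k + s.card ≤ n + 1) :
    dirichlet s (rodriguesPoly n m * Q) = 0 := by
  by_cases hm : m ∈ s
  swap
  · refine dirichlet_mul_eq_zero ?_ Q
    rw [rodriguesPoly, map_sum]
    refine Finset.sum_eq_zero fun j hj => ?_
    have : n + 1 - j ≠ 0 := by have := Finset.mem_range.mp hj; omega
    rw [map_mul, map_mul, map_pow, faceRestrict_X, if_neg hm, zero_pow this, zero_mul, mul_zero]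
  rw [Q.as_sum, Finset.mul_sum, map_sum]
  refine Finset.sum_eq_zero fun α hα => ?_
  have hdeg : α.degree = k := (hQ.degree_eq_sum_deg_support hα).symm
  by_cases hαs : α.support ⊆ s
  swap
  · rw [mul_comm]
    exact dirichlet_mul_eq_zero (by rw [faceRestrict_monomial, if_neg hαs]) _
  have hle : α m ≤ α.degree := Finsupp.le_degree m α
  obtain ⟨r, hr⟩ : ∃ r, r + α m + 2 = α.degree + s.card :=
    ⟨α.degree + s.card - 2 - α m, by omega⟩
  have hc : monomial α (coeff α Q) = C (coeff α Q) * monomial α 1 := by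
    rw [C_mul_monomial, mul_one]
  rw [hc, mul_left_comm, C_mul', map_smul, rodriguesPoly, Finset.sum_mul, map_sum]
  have h1 : ∀ j ∈ Finset.range (n + 1),
      dirichlet s (C (rodriguesCoeff n j) * (X m ^ (n + 1 - j) * coSum m ^ j) * monomial α 1) =
        rodriguesCoeff n j * ((n + 1 - j + α m)! * (j + r)!) *
          (1 / (n + 1 + α.degree + s.card - 1)! *
            ((∏ i ∈ s.erase m, ((α i)! : ℝ)) / r !)) := by
    intro j hj
    have hj' := Finset.mem_range.mp hj
    rw [mul_assoc, C_mul', map_smul, dirichlet_X_pow_mul_coSum_pow hm _ _ r α hαs hr, smul_eq_mul]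
    have : n + 1 - j + j = n + 1 := by omega
    rw [this]
    ring
  rw [Finset.sum_congr rfl h1, ← Finset.sum_mul, sum_rodriguesCoeff_mul n _ _ (by omega),
    zero_mul, smul_zero]

theorem faceRestrict_rodriguesPoly_of_ne {n : ℕ} {m k : σ} (h : m ≠ k) :
    faceRestrict {k} (rodriguesPoly n m) = 0 := by
  rw [rodriguesPoly, map_sum]
  refine Finset.sum_eq_zero fun j hj => ?_
  have : n + 1 - j ≠ 0 := by have := Finset.mem_range.mp hj; omega
  rw [map_mul, map_mul, map_pow, faceRestrict_X, if_neg (by simpa using h), zero_pow this, zero_mul,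
    mul_zero]

theorem faceRestrict_rodriguesPoly_self (n : ℕ) (m : σ) :
    faceRestrict {m} (rodriguesPoly n m) = C (rodriguesCoeff n 0) * X m ^ (n + 1) := by
  have hτ : faceRestrict {m} (coSum m) = 0 := by
    rw [coSum, map_sum]
    exact Finset.sum_eq_zero fun i hi => by rw [faceRestrict_X, if_neg (by simpa using hi)]
  rw [rodriguesPoly, map_sum, Finset.sum_eq_single_of_mem 0 (by simp)]
  · rw [faceRestrict, map_mul, map_mul, map_pow]
    simp
  · intro j _ hj
    rw [map_mul, map_mul, map_pow _ (coSum m), hτ, zero_pow hj, mul_zero, mul_zero]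

theorem dirDeriv_coSum {c : σ → ℝ} (hc : ∑ i, c i = 0) (m : σ) :
    dirDeriv c (coSum m) = -C (c m) := by
  rw [coSum, map_sum, eq_neg_iff_add_eq_zero]
  simp only [dirDeriv_X]
  rw [← map_sum, ← map_add]
  rw [← Finset.sum_compl_add_sum {m}, Finset.sum_singleton] at hc
  rw [hc, map_zero]

theorem dirDeriv_X_pow_mul_coSum_pow {c : σ → ℝ} (hc : ∑ i, c i = 0) (m : σ) (p q : ℕ) :
    dirDeriv c (X m ^ (p + 1) * coSum m ^ q) =
      (c m * (p + 1)) • (X m ^ p * coSum m ^ q) -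
        (c m * q) • (X m ^ (p + 1) * coSum m ^ (q - 1)) := by
  rw [Derivation.leibniz, Derivation.leibniz_pow, Derivation.leibniz_pow, dirDeriv_X,
    dirDeriv_coSum hc]
  simp only [Nat.add_sub_cancel, smul_eq_mul, nsmul_eq_mul, smul_eq_C_mul, map_mul, map_add,
    map_natCast, map_one]
  push_cast
  ring

/-- On its own face `F_m`, the function `rodriguesPoly n m` has a nonzero mean normal derivative. -/
theorem dirichlet_dirDeriv_rodriguesPoly_self {n : ℕ} {m : σ} (hF : ({m}ᶜ : Finset σ).Nonempty)
    {c : σ → ℝ} (hcm : c m ≠ 0) :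
    dirichlet {m}ᶜ (dirDeriv c (rodriguesPoly n m)) ≠ 0 := by
  have h1 : rodriguesPoly n m = X m * ((∑ j ∈ Finset.range n,
      C (rodriguesCoeff n j) * (X m ^ (n - 1 - j) * coSum m ^ j)) * X m +
        C (rodriguesCoeff n n) * coSum m ^ n) := by
    rw [rodriguesPoly, Finset.sum_range_succ, mul_add, Finset.sum_mul, Finset.mul_sum]
    congr 1
    · refine Finset.sum_congr rfl fun j hj => ?_
      have : n + 1 - j = (n - 1 - j) + 2 := by have := Finset.mem_range.mp hj; omega
      rw [this]
      ring
    · rw [Nat.add_sub_cancel_left]; ring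
  have hX : faceRestrict {m}ᶜ (X m : MvPolynomial σ ℝ) = 0 := by simp [faceRestrict_X]
  rw [h1, Derivation.leibniz, dirDeriv_X]
  simp only [smul_eq_mul]
  rw [map_add, dirichlet_mul_eq_zero hX, zero_add, add_mul, map_add, mul_comm _ (X m),
    mul_assoc (X m), dirichlet_mul_eq_zero hX, zero_add, mul_assoc, C_mul', map_smul,
    mul_comm, C_mul', map_smul, smul_eq_mul, smul_eq_mul]
  exact mul_ne_zero (rodriguesCoeff_ne_zero le_rfl)
    (mul_ne_zero hcm (dirichlet_coSum_pow_ne_zero hF n))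

/-- On the other faces, the mean normal derivative of `rodriguesPoly n m` is zero: it is
proportional to the integral of `g' s * (1 - s)`, that is of `g`, where `g` is the Rodrigues
polynomial. -/
theorem dirichlet_dirDeriv_rodriguesPoly_of_ne {n : ℕ} (hn : 0 < n) {m k : σ} (hmk : m ≠ k)
    (hcard : Fintype.card σ = 4) {c : σ → ℝ} (hc : ∑ i, c i = 0) :
    dirichlet {k}ᶜ (dirDeriv c (rodriguesPoly n m)) = 0 := by
  have hm : m ∈ ({k}ᶜ : Finset σ) := by simpa using hmk
  have hs : ({k}ᶜ : Finset σ).card = 3 := by rw [Finset.card_compl, hcard]; rfl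
  have hbeta : ∀ p q : ℕ, dirichlet {k}ᶜ (X m ^ p * coSum m ^ q) =
      (p ! * (q + 1)! : ℝ) / (p + q + 2)! := by
    intro p q
    have h := dirichlet_X_pow_mul_coSum_pow hm p q 1 0 (by simp) (by simp [hs])
    rw [hs] at h
    simpa using h
  have hterm : ∀ j ∈ Finset.range (n + 1),
      dirichlet {k}ᶜ (dirDeriv c (X m ^ (n + 1 - j) * coSum m ^ j)) =
        c m / (n + 2)! * ((n + 1 - j + 0)! * (j + 0)!) := by
    intro j hj
    have hj' := Finset.mem_range.mp hj
    obtain ⟨p, hp⟩ : ∃ p, n + 1 - j = p + 1 := ⟨n - j, by omega⟩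
    rw [hp, dirDeriv_X_pow_mul_coSum_pow hc, map_sub, map_smul, map_smul, hbeta, smul_eq_mul,
      smul_eq_mul, add_zero, add_zero, Nat.factorial_succ p]
    rcases j with _ | j
    · have e1 : p + 0 + 2 = n + 2 := by omega
      rw [e1]
      push_cast
      simp
      ring
    · have e1 : p + (j + 1) + 2 = n + 2 := by omega
      have e2 : p + 1 + j + 2 = n + 2 := by omega
      rw [Nat.add_sub_cancel, hbeta, e1, e2, Nat.factorial_succ p, Nat.factorial_succ (j + 1),
        Nat.factorial_succ j]
      push_cast
      field_simp
      ring
  rw [rodriguesPoly, map_sum, map_sum]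
  have h2 : ∀ j ∈ Finset.range (n + 1),
      dirichlet {k}ᶜ (dirDeriv c (C (rodriguesCoeff n j) * (X m ^ (n + 1 - j) * coSum m ^ j))) =
        c m / (n + 2)! * (rodriguesCoeff n j * ((n + 1 - j + 0)! * (j + 0)!)) := by
    intro j hj
    rw [C_mul', Derivation.map_smul, map_smul, hterm j hj, smul_eq_mul]
    ring
  rw [Finset.sum_congr rfl h2, ← Finset.mul_sum, sum_rodriguesCoeff_mul n 0 0 hn, mul_zero]

/-- A polynomial of degree `n + 1` is determined by its moments on the edges, the faces and the
tetrahedron together with the means of its normal derivatives on the faces. -/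
theorem eq_zero_of_moments (hcard : Fintype.card σ = 4) {n : ℕ} (hn : 0 < n)
    {c : σ → σ → ℝ} (hc : ∀ m, ∑ i, c m i = 0) (hcm : ∀ m, c m m ≠ 0) {P : MvPolynomial σ ℝ}
    (hP : P.IsHomogeneous (n + 1))
    (h1 : ∀ s : Finset σ, 2 ≤ s.card → ∀ Q k, Q.IsHomogeneous k → k + s.card ≤ n + 1 →
      dirichlet s (P * Q) = 0)
    (h2 : ∀ m, dirichlet {m}ᶜ (dirDeriv (c m) P) = 0) : P = 0 := by
  -- the coefficients are chosen so that `W` vanishes at the vertices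
  set a : σ → ℝ := fun m => P.coeff (Finsupp.single m (n + 1)) / rodriguesCoeff n 0 with ha
  set W : MvPolynomial σ ℝ := P - ∑ m, C (a m) * rodriguesPoly n m with hW
  have hWh : W.IsHomogeneous (n + 1) := hP.sub (IsHomogeneous.sum _ _ _ fun m _ =>
    (isHomogeneous_rodriguesPoly n m).C_mul _)
  have hW1 : ∀ s : Finset σ, 2 ≤ s.card → ∀ Q k, Q.IsHomogeneous k → k + s.card ≤ n + 1 →
      dirichlet s (W * Q) = 0 := by
    intro s hs Q k hQ hk
    rw [hW, sub_mul, map_sub, h1 s hs Q k hQ hk, Finset.sum_mul, map_sum, zero_sub, neg_eq_zero]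
    refine Finset.sum_eq_zero fun m _ => ?_
    rw [mul_assoc, C_mul', map_smul, dirichlet_rodriguesPoly_mul hs hQ hk, smul_zero]
  have hC : ∀ (s : Finset σ) (r : ℝ), faceRestrict s (C r) = C r := fun s r =>
    (faceRestrict s).commutes r
  have hW2 : ∀ s : Finset σ, s.Nonempty → faceRestrict s W = 0 := by
    intro s
    induction s using Finset.strongInduction with
    | H s ih =>
      intro hs
      rcases Nat.lt_or_ge s.card 2 with h | h
      · obtain ⟨k, rfl⟩ := Finset.card_eq_one.mp
          (le_antisymm (Nat.lt_succ_iff.mp h) hs.card_pos)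
        rw [hW, map_sub, map_sum, Finset.sum_eq_single_of_mem k (Finset.mem_univ k), map_mul, hC,
          faceRestrict_rodriguesPoly_self, faceRestrict_singleton_of_isHomogeneous hP, ← mul_assoc,
          ← map_mul, ha, div_mul_cancel₀ _ (rodriguesCoeff_ne_zero (Nat.zero_le n)), sub_self]
        intro m _ hm
        rw [map_mul, faceRestrict_rodriguesPoly_of_ne hm, mul_zero]
      · exact faceRestrict_eq_zero_of_moments hs hWh (fun t ht hne => ih t ht hne)
          (Nat.succ_ne_zero n) (hW1 s h)
  have hne : (Finset.univ : Finset σ).Nonempty := by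
    rw [← Finset.card_pos, Finset.card_univ, hcard]; norm_num
  have hW0 : W = 0 := by
    ext α
    exact faceRestrict_eq_zero_iff.mp (hW2 _ hne) α (Finset.subset_univ _)
  have hPsum : P = ∑ m, C (a m) * rodriguesPoly n m := sub_eq_zero.mp hW0
  have ha0 : ∀ m, a m = 0 := by
    intro m
    have hF : ({m}ᶜ : Finset σ).Nonempty := by
      rw [← Finset.card_pos, Finset.card_compl, hcard]; simp
    have h := h2 m
    rw [hPsum, map_sum, map_sum, Finset.sum_eq_single_of_mem m (Finset.mem_univ m), C_mul',
      Derivation.map_smul, map_smul, smul_eq_mul] at h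
    · exact (mul_eq_zero.mp h).resolve_right (dirichlet_dirDeriv_rodriguesPoly_self hF (hcm m))
    · intro k _ hk
      rw [C_mul', Derivation.map_smul, map_smul,
        dirichlet_dirDeriv_rodriguesPoly_of_ne hn hk hcard (hc m), smul_zero]
  rw [hPsum]
  exact Finset.sum_eq_zero fun m _ => by rw [ha0 m, map_zero, zero_mul]

end Core

section Barycentric

open scoped Nat

/-! ### Polynomial functions in barycentric coordinates -/

variable (T : Tetra)

/-- Evaluation of a polynomial in the four barycentric coordinates of `T`. -/
def baryEval : MvPolynomial (Fin 4) ℝ →ₐ[ℝ] (E3 → ℝ) := MvPolynomial.aeval (bary T)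

theorem baryEval_apply (P : MvPolynomial (Fin 4) ℝ) (x : E3) :
    baryEval T P x = MvPolynomial.eval (fun i => bary T i x) P := by
  induction P using MvPolynomial.induction_on with
  | C a => simp [baryEval]
  | add p q hp hq => simp only [map_add, Pi.add_apply, hp, hq]
  | mul_X p i hp => simp only [map_mul, Pi.mul_apply, hp]; simp [baryEval]

theorem sum_bary (x : E3) : ∑ i, bary T i x = 1 := (vertexBasis T).sum_coord_apply_eq_one x

theorem evalMap_apply (p : MvPolynomial (Fin 3) ℝ) (x : E3) :
    evalMap p x = MvPolynomial.eval (fun j => x j) p := by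
  simp [evalMap]

theorem apply_eq_sum_bary (x : E3) (j : Fin 3) : x j = ∑ i, bary T i x * T.points i j := by
  conv_lhs => rw [← (vertexBasis T).linear_combination_coord_eq_self x]
  simp only [WithLp.ofLp_sum, Finset.sum_apply]
  rfl

theorem bary_eq_linear_add (i : Fin 4) (x : E3) :
    bary T i x = ((vertexBasis T).coord i).linear x + bary T i 0 := by
  have h := ((vertexBasis T).coord i).map_vadd 0 x
  simpa [bary] using h

theorem hasFDerivAt_bary (i : Fin 4) (x : E3) :
    HasFDerivAt (bary T i)
      (LinearMap.toContinuousLinearMap ((vertexBasis T).coord i).linear) x := by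
  have h : bary T i = fun x =>
      LinearMap.toContinuousLinearMap ((vertexBasis T).coord i).linear x + bary T i 0 := by
    ext x; exact bary_eq_linear_add T i x
  rw [h]
  exact (ContinuousLinearMap.hasFDerivAt _).add_const _

theorem polySpace_natCast (n : ℕ) :
    polySpace n = (MvPolynomial.restrictTotalDegree (Fin 3) ℝ n).map evalMap := by
  simp only [polySpace, MvPolynomial.restrictTotalDegree, Nat.cast_le]
  rfl

theorem polySpace_mono {k l : ℤ} (h : k ≤ l) : polySpace k ≤ polySpace l :=
  Submodule.map_mono (MvPolynomial.restrictSupport_mono ℝ fun _ ha => le_trans ha h)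

theorem polySpace_of_neg {k : ℤ} (h : k < 0) : polySpace k = ⊥ := by
  have : {a : Fin 3 →₀ ℕ | (a.degree : ℤ) ≤ k} = ∅ := by
    ext a
    simp only [Set.mem_ofPred_eq, Set.mem_empty_iff_false, iff_false]
    omega
  rw [polySpace, this, MvPolynomial.restrictSupport_eq_span]
  simp

/-- Polynomial functions of degree at most `n` are the homogeneous polynomials of degree `n` in the
barycentric coordinates. -/
theorem polySpace_eq_map_baryEval (n : ℕ) :
    polySpace n = (MvPolynomial.homogeneousSubmodule (Fin 4) ℝ n).map (baryEval T).toLinearMap := by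
  apply le_antisymm
  · have h0 : polySpace n = (MvPolynomial.restrictSupport ℝ
        {a : Fin 3 →₀ ℕ | (a.degree : ℤ) ≤ n}).map evalMap := rfl
    rw [h0, MvPolynomial.restrictSupport_eq_span, Submodule.map_span_le]
    rintro _ ⟨a, ha, rfl⟩
    have ha' : a.degree ≤ n := by exact_mod_cast ha
    let L : Fin 3 → MvPolynomial (Fin 4) ℝ := fun j =>
      ∑ i, MvPolynomial.C (T.points i j) * MvPolynomial.X i
    have hL : ∀ j, (L j).IsHomogeneous 1 := fun j =>
      IsHomogeneous.sum _ _ _ fun i _ => MvPolynomial.isHomogeneous_C_mul_X _ _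
    refine ⟨(∑ i, MvPolynomial.X i) ^ (n - a.degree) * ∏ j, L j ^ a j, ?_, ?_⟩
    · have h1 : (∑ i, MvPolynomial.X i : MvPolynomial (Fin 4) ℝ).IsHomogeneous 1 :=
        IsHomogeneous.sum _ _ _ fun i _ => MvPolynomial.isHomogeneous_X ℝ i
      have h2 := (h1.pow (n - a.degree)).mul
        (IsHomogeneous.prod Finset.univ (fun j => L j ^ a j) (fun j => 1 * a j)
          fun j _ => (hL j).pow (a j))
      have h3 : a.degree = ∑ j, a j := Finsupp.degree_eq_sum a
      have h4 : 1 * (n - a.degree) + ∑ j, 1 * a j = n := by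
        simp only [one_mul]; omega
      rw [h4] at h2
      exact h2
    · ext x
      have h1 : MvPolynomial.eval (fun i => bary T i x) (∑ i, MvPolynomial.X i) = 1 := by
        simpa using sum_bary T x
      have h2 : ∀ j, MvPolynomial.eval (fun i => bary T i x) (L j) = x j := by
        intro j
        rw [apply_eq_sum_bary T x j]
        simp [L, mul_comm]
      rw [AlgHom.toLinearMap_apply, baryEval_apply, evalMap_apply, map_mul, map_pow, h1, one_pow,
        one_mul, map_prod, MvPolynomial.eval_monomial, one_mul, Finsupp.prod_fintype _ _ (by simp)]
      exact Finset.prod_congr rfl fun j _ => by rw [map_pow, h2]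
  · rintro _ ⟨P, hP, rfl⟩
    rw [polySpace_natCast]
    let q : Fin 4 → MvPolynomial (Fin 3) ℝ := fun i =>
      MvPolynomial.C (bary T i 0) + ∑ j, MvPolynomial.C
        (((vertexBasis T).coord i).linear (EuclideanSpace.single j 1)) * MvPolynomial.X j
    have hq : ∀ i, (q i).totalDegree ≤ 1 := by
      intro i
      refine (MvPolynomial.totalDegree_add _ _).trans (max_le ?_ ?_)
      · rw [MvPolynomial.totalDegree_C]; exact Nat.zero_le _
      · refine MvPolynomial.totalDegree_finsetSum_le fun j _ => ?_
        exact (MvPolynomial.isHomogeneous_C_mul_X _ _).totalDegree_le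
    have hqx : ∀ i x, MvPolynomial.eval (fun j => x j) (q i) = bary T i x := by
      intro i x
      have hx : x = ∑ j, x j • EuclideanSpace.single j (1 : ℝ) := by
        ext k
        simp [Finset.sum_apply, Pi.single_apply]
      rw [bary_eq_linear_add T i x]
      conv_rhs => rw [hx]
      simp [q, add_comm, mul_comm]
    refine ⟨MvPolynomial.aeval q P, ?_, ?_⟩
    · rw [SetLike.mem_coe, MvPolynomial.mem_restrictTotalDegree, MvPolynomial.aeval_def,
        MvPolynomial.eval₂_eq]
      refine MvPolynomial.totalDegree_finsetSum_le fun α hα => ?_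
      refine (MvPolynomial.totalDegree_mul _ _).trans ?_
      rw [MvPolynomial.algebraMap_eq, MvPolynomial.totalDegree_C, zero_add]
      refine (MvPolynomial.totalDegree_finsetProd _ _).trans ?_
      have hd : α.degree = n := (IsHomogeneous.degree_eq_sum_deg_support hP hα).symm
      rw [← hd, Finsupp.degree_apply]
      refine Finset.sum_le_sum fun i _ => (MvPolynomial.totalDegree_pow _ _).trans ?_
      simpa using Nat.mul_le_mul_left (α i) (hq i)
    · ext x
      rw [evalMap_apply, AlgHom.toLinearMap_apply, baryEval_apply,
        ← MvPolynomial.coe_aeval_eq_eval, ← MvPolynomial.coe_aeval_eq_eval]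
      simp only [RingHom.coe_coe]
      rw [← AlgHom.comp_apply, MvPolynomial.comp_aeval]
      congr 2
      ext i
      rw [← hqx i x, ← MvPolynomial.coe_aeval_eq_eval]
      rfl

theorem baryEval_mem_polySpace {P : MvPolynomial (Fin 4) ℝ} {n : ℕ} (hP : P.IsHomogeneous n)
    {k : ℤ} (hk : (n : ℤ) ≤ k) : baryEval T P ∈ polySpace k := by
  refine polySpace_mono hk ?_
  rw [polySpace_eq_map_baryEval T]
  exact ⟨P, hP, rfl⟩

theorem exists_baryEval_of_mem_polySpace {f : E3 → ℝ} {k : ℤ} (hf : f ∈ polySpace k) :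
    ∃ P : MvPolynomial (Fin 4) ℝ, f = baryEval T P := by
  rcases lt_or_ge k 0 with hk | hk
  · rw [polySpace_of_neg hk, Submodule.mem_bot] at hf
    exact ⟨0, by rw [hf, map_zero]⟩
  · lift k to ℕ using hk
    rw [polySpace_eq_map_baryEval T] at hf
    obtain ⟨P, -, rfl⟩ := hf
    exact ⟨P, rfl⟩

/-! ### The normal derivative in barycentric coordinates -/

/-- The slopes of the barycentric coordinates in the direction of the outer normal on `F_m`. -/
def normalSlope (m i : Fin 4) : ℝ := ((vertexBasis T).coord i).linear (outerNormal T m)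

theorem normalDeriv_baryEval (m : Fin 4) (P : MvPolynomial (Fin 4) ℝ) :
    normalDeriv T m (baryEval T P) = baryEval T (dirDeriv (normalSlope T m) P) := by
  ext x
  have h : ∃ L : E3 →L[ℝ] ℝ, HasFDerivAt (baryEval T P) L x ∧
      L (outerNormal T m) = baryEval T (dirDeriv (normalSlope T m) P) x := by
    induction P using MvPolynomial.induction_on with
    | C a =>
      refine ⟨0, ?_, ?_⟩
      · have : baryEval T (MvPolynomial.C a) = fun _ => a := by
          ext y; rw [baryEval_apply, MvPolynomial.eval_C]
        rw [this]
        exact hasFDerivAt_const a x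
      · simp [dirDeriv]
    | add p q hp hq =>
      obtain ⟨L, hL, hL'⟩ := hp
      obtain ⟨M, hM, hM'⟩ := hq
      refine ⟨L + M, ?_, ?_⟩
      · rw [map_add]; exact hL.add hM
      · simp [hL', hM']
    | mul_X p i hp =>
      obtain ⟨L, hL, hL'⟩ := hp
      have hX : baryEval T (MvPolynomial.X i) = bary T i := MvPolynomial.aeval_X _ _
      refine ⟨baryEval T p x • LinearMap.toContinuousLinearMap ((vertexBasis T).coord i).linear +
        bary T i x • L, ?_, ?_⟩
      · rw [map_mul, hX]; exact hL.mul (hasFDerivAt_bary T i x)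
      · rw [Derivation.leibniz, dirDeriv_X]
        have hC : baryEval T (MvPolynomial.C (normalSlope T m i)) x =
            ((vertexBasis T).coord i).linear (outerNormal T m) := by
          rw [baryEval_apply, MvPolynomial.eval_C]; rfl
        simp only [smul_eq_mul, map_add, map_mul, Pi.add_apply, Pi.mul_apply, hX, hC,
          add_apply, smul_apply, hL',
          LinearMap.coe_toContinuousLinearMap']
  obtain ⟨L, hL, hL'⟩ := h
  rw [normalDeriv, hL.fderiv, hL']

theorem sum_normalSlope (m : Fin 4) : ∑ i, normalSlope T m i = 0 := by
  have h1 : ∀ i, normalSlope T m i = bary T i (outerNormal T m) - bary T i 0 := fun i => by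
    rw [bary_eq_linear_add T i (outerNormal T m)]; simp [normalSlope]
  simp_rw [h1]
  rw [Finset.sum_sub_distrib, sum_bary, sum_bary, sub_self]

theorem normalSlope_self_ne_zero (m : Fin 4) : normalSlope T m m ≠ 0 := by
  have hfoot : bary T m (T.altitudeFoot m) = 0 := by
    refine affineSpan_induction (p := fun x => bary T m x = 0)
      (T.altitudeFoot_mem_affineSpan_image_compl m) ?_ ?_
    · rintro _ ⟨j, hj, rfl⟩
      rw [bary_vertex, if_neg fun h => hj (by simp [h])]
    · intro c u v w hu hv hw
      simp only [bary] at hu hv hw ⊢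
      rw [AffineMap.map_vadd, map_smul, AffineMap.linearMap_vsub, hu, hv, hw]
      simp
  have h := (T.height_pos m).ne'
  have h1 : normalSlope T m m =
      (T.height m)⁻¹ * (bary T m (T.altitudeFoot m) - bary T m (T.points m)) := by
    rw [normalSlope, outerNormal, map_smul, smul_eq_mul, ← vsub_eq_sub (T.altitudeFoot m),
      AffineMap.linearMap_vsub]
    rfl
  rw [h1, hfoot, bary_vertex, if_pos rfl]
  simpa using h

/-! ### Moments in barycentric coordinates -/

variable {T}

/-- The simplex `S` is the face of `T` with vertex set `s`. -/
def HasVertexSet {d : ℕ} (T : Tetra) (S : Affine.Simplex ℝ E3 d) (s : Finset (Fin 4)) : Prop :=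
  ∃ j : Fin (d + 1) → Fin 4, Function.Injective j ∧ (∀ k, S.points k = T.points (j k)) ∧
    Finset.univ.image j = s

theorem hasVertexSet_face {d : ℕ} {s : Finset (Fin 4)} (h : s.card = d + 1) :
    HasVertexSet T (T.face h) s :=
  ⟨s.orderEmbOfFin h, (s.orderEmbOfFin h).injective, fun _ => rfl, by simp⟩

theorem hasVertexSet_edge (e : EdgeIdx) : HasVertexSet T (edge T e) e.1 := hasVertexSet_face e.2

theorem hasVertexSet_faceOpposite (m : Fin 4) : HasVertexSet T (face T m) {m}ᶜ :=
  hasVertexSet_face _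

theorem hasVertexSet_self : HasVertexSet T T Finset.univ :=
  ⟨id, Function.injective_id, fun _ => rfl, by simp⟩

theorem bary_simplexPoint {d : ℕ} {S : Affine.Simplex ℝ E3 d} {j : Fin (d + 1) → Fin 4}
    (hS : ∀ k, S.points k = T.points (j k)) (t : Fin d → ℝ) (i : Fin 4) :
    bary T i (simplexPoint S t) = facePoint j t i := by
  have h1 := Finset.univ.map_affineCombination S.points (refBary t) (sum_refBary t)
    ((vertexBasis T).coord i)
  rw [Finset.affineCombination_eq_linear_combination _ _ _ (sum_refBary t),
    Finset.affineCombination_eq_linear_combination _ _ _ (sum_refBary t)] at h1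
  refine h1.trans (Finset.sum_congr rfl fun k _ => ?_)
  have h2 : (vertexBasis T).coord i (S.points k) = if i = j k then 1 else 0 := by
    rw [hS]; exact bary_vertex T i (j k)
  simp only [Function.comp_apply, h2, smul_eq_mul, mul_ite, mul_one, mul_zero, eq_comm (a := i)]

variable {d : ℕ} {S : Affine.Simplex ℝ E3 d} {s : Finset (Fin 4)}

theorem HasVertexSet.moment_baryEval (hS : HasVertexSet T S s) (P Q : MvPolynomial (Fin 4) ℝ) :
    moment S (baryEval T P) (fun x => baryEval T Q x) = d ! * dirichlet s (P * Q) := by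
  obtain ⟨j, hj, hjS, rfl⟩ := hS
  rw [moment_eq_setIntegral, dirichlet_image_eq_setIntegral hj]
  simp only [baryEval_apply, bary_simplexPoint hjS, map_mul]

theorem HasVertexSet.bary_eq_zero (hS : HasVertexSet T S s) {x : E3} (hx : x ∈ S.closedInterior)
    {i : Fin 4} (hi : i ∉ s) : bary T i x = 0 := by
  obtain ⟨j, hj, hjS, rfl⟩ := hS
  rw [← image_simplexPoint] at hx
  obtain ⟨t, -, rfl⟩ := hx
  rw [bary_simplexPoint hjS, facePoint_of_notMem t hi]

theorem HasVertexSet.card_eq (hS : HasVertexSet T S s) : s.card = d + 1 := by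
  obtain ⟨j, hj, -, rfl⟩ := hS
  rw [Finset.card_image_of_injective _ hj, Finset.card_fin]

theorem exists_baryEval_of_mem_polyOn (T : Tetra) {k : ℤ} {G : Set E3} {q : G → ℝ}
    (hq : q ∈ polyOn k G) : ∃ Q : MvPolynomial (Fin 4) ℝ, q = fun x : G => baryEval T Q x := by
  obtain ⟨f, hf, rfl⟩ := hq
  obtain ⟨Q, rfl⟩ := exists_baryEval_of_mem_polySpace T hf
  exact ⟨Q, rfl⟩

theorem baryEval_mem_polyOn (T : Tetra) {Q : MvPolynomial (Fin 4) ℝ} {n : ℕ}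
    (hQ : Q.IsHomogeneous n) {k : ℤ} (hk : (n : ℤ) ≤ k) (G : Set E3) :
    (fun x : G => baryEval T Q x) ∈ polyOn k G :=
  ⟨_, baryEval_mem_polySpace T hQ hk, rfl⟩

/-- The moments of a polynomial in the barycentric coordinates on a face of `T`, as a functional on
the test polynomials of degree at most `k`. It is linear in both arguments because the integrals
are given by `dirichlet`. -/
def momentDual (hS : HasVertexSet T S s) (k : ℤ) :
    MvPolynomial (Fin 4) ℝ →ₗ[ℝ] Dual ℝ (polyOn k S.closedInterior) :=
  LinearMap.mk₂ ℝ (fun P q => moment S (baryEval T P) q.1)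
    (by
      rintro P P' ⟨q, hq⟩
      obtain ⟨Q, rfl⟩ := exists_baryEval_of_mem_polyOn T hq
      dsimp only
      rw [hS.moment_baryEval, hS.moment_baryEval, hS.moment_baryEval, add_mul, map_add, mul_add])
    (by
      rintro c P ⟨q, hq⟩
      obtain ⟨Q, rfl⟩ := exists_baryEval_of_mem_polyOn T hq
      dsimp only
      rw [hS.moment_baryEval, hS.moment_baryEval, smul_mul_assoc, map_smul, smul_eq_mul,
        smul_eq_mul, mul_left_comm])
    (by
      rintro P ⟨q, hq⟩ ⟨q', hq'⟩
      obtain ⟨Q, rfl⟩ := exists_baryEval_of_mem_polyOn T hq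
      obtain ⟨Q', rfl⟩ := exists_baryEval_of_mem_polyOn T hq'
      have h : (fun x : S.closedInterior => baryEval T Q x) +
          (fun x : S.closedInterior => baryEval T Q' x) =
            fun x : S.closedInterior => baryEval T (Q + Q') x := by
        ext x; simp
      simp only [Submodule.coe_add, h]
      rw [hS.moment_baryEval, hS.moment_baryEval, hS.moment_baryEval, mul_add, map_add, mul_add])
    (by
      rintro c P ⟨q, hq⟩
      obtain ⟨Q, rfl⟩ := exists_baryEval_of_mem_polyOn T hq
      have h : c • (fun x : S.closedInterior => baryEval T Q x) =
          fun x : S.closedInterior => baryEval T (c • Q) x := by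
        ext x; simp
      simp only [Submodule.coe_smul, h]
      rw [hS.moment_baryEval, hS.moment_baryEval, mul_smul_comm, map_smul, smul_eq_mul,
        smul_eq_mul, mul_left_comm])

theorem momentDual_apply (hS : HasVertexSet T S s) (k : ℤ) (P : MvPolynomial (Fin 4) ℝ)
    (q : polyOn k S.closedInterior) : momentDual hS k P q = moment S (baryEval T P) q.1 := rfl

theorem dirichlet_eq_zero_of_momentDual (hS : HasVertexSet T S s) {k : ℤ}
    {P : MvPolynomial (Fin 4) ℝ} (h : momentDual hS k P = 0) {Q : MvPolynomial (Fin 4) ℝ} {n : ℕ}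
    (hQ : Q.IsHomogeneous n) (hn : (n : ℤ) ≤ k) : dirichlet s (P * Q) = 0 := by
  have h1 := LinearMap.congr_fun h ⟨_, baryEval_mem_polyOn T hQ hn S.closedInterior⟩
  rw [momentDual_apply, hS.moment_baryEval, LinearMap.zero_apply] at h1
  exact (mul_eq_zero.mp h1).resolve_left (by positivity)

theorem momentDual_eq_zero_of_faceRestrict (hS : HasVertexSet T S s) (k : ℤ)
    {P : MvPolynomial (Fin 4) ℝ} (h : faceRestrict s P = 0) : momentDual hS k P = 0 := by
  ext ⟨q, hq⟩
  obtain ⟨Q, rfl⟩ := exists_baryEval_of_mem_polyOn T hq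
  rw [momentDual_apply, hS.moment_baryEval, dirichlet_mul_eq_zero h, mul_zero,
    LinearMap.zero_apply]

/-! ### Dimensions -/

theorem polyOn_le_span (hS : HasVertexSet T S s) (n : ℕ) :
    polyOn n S.closedInterior ≤ Submodule.span ℝ (Set.range
      fun (α : s.finsuppAntidiag n) (x : S.closedInterior) =>
        baryEval T (MvPolynomial.monomial α.1 1) x) := by
  rintro _ ⟨f, hf, rfl⟩
  rw [polySpace_eq_map_baryEval T] at hf
  obtain ⟨Q, hQ, rfl⟩ := hf
  have h1 : LinearMap.funLeft ℝ ℝ (Subtype.val : S.closedInterior → E3) (baryEval T Q) =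
      LinearMap.funLeft ℝ ℝ (Subtype.val : S.closedInterior → E3)
        (baryEval T (faceRestrict s Q)) := by
    ext x
    simp only [LinearMap.funLeft_apply, baryEval_apply, faceRestrict]
    rw [← MvPolynomial.coe_aeval_eq_eval]
    simp only [RingHom.coe_coe]
    rw [← AlgHom.comp_apply, MvPolynomial.comp_aeval]
    congr 2
    ext i
    split_ifs with hi
    · simp
    · simpa using hS.bary_eq_zero x.2 hi
  rw [AlgHom.toLinearMap_apply, h1, (faceRestrict s Q).as_sum, map_sum, map_sum]
  refine Submodule.sum_mem _ fun α hα => ?_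
  have hα' := MvPolynomial.mem_support_iff.mp hα
  rw [coeff_faceRestrict] at hα'
  have hαs : α.support ⊆ s := by by_contra h; rw [if_neg h] at hα'; exact hα' rfl
  rw [if_pos hαs] at hα'
  have hdeg : α.degree = n := by by_contra h; exact hα' (IsHomogeneous.coeff_eq_zero hQ h)
  have h2 : MvPolynomial.monomial α ((faceRestrict s Q).coeff α) =
      (faceRestrict s Q).coeff α • MvPolynomial.monomial α 1 := by
    rw [MvPolynomial.smul_monomial, smul_eq_mul, mul_one]
  rw [h2, map_smul, map_smul]
  refine Submodule.smul_mem _ _ (Submodule.subset_span ?_)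
  refine ⟨⟨α, ?_⟩, rfl⟩
  rw [Finset.mem_finsuppAntidiag]
  refine ⟨?_, hαs⟩
  rw [← hdeg, Finsupp.degree_apply]
  exact (Finset.sum_subset hαs fun i _ hi => by simpa using hi).symm

theorem polyOn_of_neg {k : ℤ} (hk : k < 0) (G : Set E3) : polyOn k G = ⊥ := by
  rw [polyOn, polySpace_of_neg hk, Submodule.map_bot]

theorem finiteDimensional_polyOn (hS : HasVertexSet T S s) (k : ℤ) :
    FiniteDimensional ℝ (polyOn k S.closedInterior) := by
  rcases lt_or_ge k 0 with hk | hk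
  · rw [polyOn_of_neg hk]; infer_instance
  · lift k to ℕ using hk
    have := FiniteDimensional.span_of_finite ℝ (Set.finite_range
      fun (α : s.finsuppAntidiag k) (x : S.closedInterior) =>
        baryEval T (MvPolynomial.monomial α.1 1) x)
    exact Submodule.finiteDimensional_of_le (polyOn_le_span hS k)

/-- The bound by the number of monomials of degree `k` in the barycentric coordinates of the face.
The number `n` bounds `k + s.card - 1`, so that `k` may be negative. -/
theorem finrank_polyOn_le (hS : HasVertexSet T S s) {k : ℤ} {n : ℕ} (hk : k + s.card ≤ n + 1) :
    finrank ℝ (polyOn k S.closedInterior) ≤ n.choose (s.card - 1) := by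
  have hc := hS.card_eq
  rcases lt_or_ge k 0 with h | h
  · rw [polyOn_of_neg h, finrank_bot]; exact Nat.zero_le _
  · lift k to ℕ using h
    have := FiniteDimensional.span_of_finite ℝ (Set.finite_range
      fun (α : s.finsuppAntidiag k) (x : S.closedInterior) =>
        baryEval T (MvPolynomial.monomial α.1 1) x)
    refine (Submodule.finrank_mono (polyOn_le_span hS k)).trans
      ((finrank_range_le_card _).trans ?_)
    rw [Fintype.card_coe, Finset.card_finsuppAntidiag_nat_eq_choose]
    have h1 : s.card + k - 1 = k + (s.card - 1) := by omega
    rw [h1, Nat.choose_symm_add]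
    exact Nat.choose_le_choose _ (by omega)

theorem finrank_homogeneousSubmodule (n : ℕ) :
    finrank ℝ (MvPolynomial.homogeneousSubmodule (Fin 4) ℝ n) = (n + 3).choose 3 := by
  have h : MvPolynomial.homogeneousSubmodule (Fin 4) ℝ n = MvPolynomial.restrictSupport ℝ
      ((Finset.univ.finsuppAntidiag n : Finset (Fin 4 →₀ ℕ)) : Set (Fin 4 →₀ ℕ)) := by
    rw [MvPolynomial.homogeneousSubmodule_eq_finsupp_supported]
    congr 1
    ext α
    simp [Finsupp.degree_eq_sum]
  rw [h, finrank_eq_card_basis (MvPolynomial.basisRestrictSupport ℝ _)]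
  simp only [Finset.coe_sort_coe, Fintype.card_coe]
  rw [Finset.card_finsuppAntidiag_nat_eq_choose, Finset.card_univ, Fintype.card_fin]
  have h1 : 4 + n - 1 = n + 3 := by omega
  rw [h1, Nat.choose_symm_add]

instance (n : ℕ) : FiniteDimensional ℝ (MvPolynomial.homogeneousSubmodule (Fin 4) ℝ n) :=
  FiniteDimensional.of_finrank_pos (by
    rw [finrank_homogeneousSubmodule]; exact Nat.choose_pos (by omega))

end Barycentric

section Unisolvence

/-! ### The nodal functions of the normal derivative moments -/

variable {T : Tetra}

theorem baryEval_bubblePoly (T : Tetra) (m : Fin 4) :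
    baryEval T (bubblePoly m) = faceBubble T m := by
  ext x
  simp [baryEval_apply, bubblePoly, faceBubble]

theorem mem_bubbleSpace_iff {m : Fin 4} {n : ℕ} {f : E3 → ℝ} :
    f ∈ bubbleSpace T m n ↔ ∃ P ∈ MvPolynomial.homogeneousSubmodule (Fin 4) ℝ n,
      f = baryEval T (bubblePoly m ^ 2 * P) := by
  rw [bubbleSpace, polySpace_eq_map_baryEval T]
  simp only [Submodule.mem_map, AlgHom.toLinearMap_apply, exists_exists_and_eq_and,
    LinearMap.mulLeft_apply, map_mul, map_pow, baryEval_bubblePoly, eq_comm (a := f)]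

/-- The moments of `b_{F_m}² P` on `F_m` and on `T` and of its normal derivative on `F_m`, as a
linear map in the homogeneous polynomial `P` of degree `n`. They determine `P` if `ℓ = n + 2`. -/
def bubbleMoments (T : Tetra) (m : Fin 4) (ℓ n : ℕ) :
    MvPolynomial.homogeneousSubmodule (Fin 4) ℝ n →ₗ[ℝ]
      Dual ℝ (polyOn ((ℓ : ℤ) - 3) (face T m).closedInterior) ×
      Dual ℝ (polyOn ((ℓ : ℤ) - 4) T.closedInterior) ×
      Dual ℝ (polyOn ((ℓ : ℤ) - 2) (face T m).closedInterior) :=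
  ((momentDual (hasVertexSet_faceOpposite m) _).prod ((momentDual hasVertexSet_self _).prod
    (momentDual (hasVertexSet_faceOpposite m) _ ∘ₗ (dirDeriv (normalSlope T m)).toLinearMap))) ∘ₗ
      LinearMap.mulLeft ℝ (bubblePoly m ^ 2) ∘ₗ Submodule.subtype _

theorem bubbleMoments_apply (m : Fin 4) (ℓ n : ℕ)
    (P : MvPolynomial.homogeneousSubmodule (Fin 4) ℝ n) :
    bubbleMoments T m ℓ n P =
      (momentDual (hasVertexSet_faceOpposite m) _ (bubblePoly m ^ 2 * P.1),
        momentDual hasVertexSet_self _ (bubblePoly m ^ 2 * P.1),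
        momentDual (hasVertexSet_faceOpposite m) _
          (dirDeriv (normalSlope T m) (bubblePoly m ^ 2 * P.1))) := rfl

theorem card_compl_singleton (m : Fin 4) : ({m}ᶜ : Finset (Fin 4)).card = 3 := by
  rw [Finset.card_compl, Fintype.card_fin, Finset.card_singleton]

theorem bubbleMoments_injective (m : Fin 4) (n : ℕ) :
    Function.Injective (bubbleMoments T m (n + 2) n) := by
  rw [← LinearMap.ker_eq_bot, LinearMap.ker_eq_bot']
  rintro ⟨P, hP⟩ h
  rw [bubbleMoments_apply, Prod.mk_eq_zero, Prod.mk_eq_zero] at h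
  obtain ⟨h1, h2, h3⟩ := h
  refine Subtype.ext (eq_zero_of_bubble_moments (m := m) (c := normalSlope T m) ?_
    (sum_normalSlope T m) (normalSlope_self_ne_zero T m) hP ?_ ?_ ?_)
  · rw [← Finset.card_pos, card_compl_singleton]; norm_num
  · exact fun Q k hQ hk => dirichlet_eq_zero_of_momentDual _ h1 hQ (by push_cast; omega)
  · exact fun Q k hQ hk => dirichlet_eq_zero_of_momentDual _ h2 hQ (by push_cast; omega)
  · exact fun Q k hQ hk => dirichlet_eq_zero_of_momentDual _ h3 hQ (by push_cast; omega)

/-- An injective linear map into a space that is not larger is bijective. -/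
theorem bijective_of_injective_of_finrank_le {V W : Type*} [AddCommGroup V] [Module ℝ V]
    [AddCommGroup W] [Module ℝ W] [FiniteDimensional ℝ V] [FiniteDimensional ℝ W] {f : V →ₗ[ℝ] W}
    (hf : Function.Injective f) (h : finrank ℝ W ≤ finrank ℝ V) : Function.Bijective f :=
  ⟨hf, (LinearMap.injective_iff_surjective_of_finrank_eq_finrank
    (le_antisymm (LinearMap.finrank_le_finrank_of_injective hf) h)).mp hf⟩

theorem bubbleMoments_bijective (m : Fin 4) (n : ℕ) :
    Function.Bijective (bubbleMoments T m (n + 2) n) := by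
  have hF := hasVertexSet_faceOpposite (T := T) m
  have hT := hasVertexSet_self (T := T)
  have i1 := finiteDimensional_polyOn hF (((n + 2 : ℕ) : ℤ) - 3)
  have i2 := finiteDimensional_polyOn hT (((n + 2 : ℕ) : ℤ) - 4)
  have i3 := finiteDimensional_polyOn hF (((n + 2 : ℕ) : ℤ) - 2)
  refine bijective_of_injective_of_finrank_le (bubbleMoments_injective m n) ?_
  rw [finrank_prod, finrank_prod, Subspace.dual_finrank_eq, Subspace.dual_finrank_eq,
    Subspace.dual_finrank_eq, finrank_homogeneousSubmodule]
  have h1 := finrank_polyOn_le hF (k := ((n + 2 : ℕ) : ℤ) - 3) (n := n + 1)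
    (by rw [card_compl_singleton]; push_cast; omega)
  have h2 := finrank_polyOn_le hT (k := ((n + 2 : ℕ) : ℤ) - 4) (n := n + 1)
    (by rw [Finset.card_univ, Fintype.card_fin]; push_cast; omega)
  have h3 := finrank_polyOn_le hF (k := ((n + 2 : ℕ) : ℤ) - 2) (n := n + 2)
    (by rw [card_compl_singleton]; push_cast; omega)
  rw [card_compl_singleton] at h1 h3
  rw [Finset.card_univ, Fintype.card_fin] at h2
  have e1 : (n + 3).choose 3 = (n + 2).choose 2 + (n + 2).choose 3 := rfl
  have e2 : (n + 2).choose 3 = (n + 1).choose 2 + (n + 1).choose 3 := rfl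
  simp only [Nat.reduceSub] at h1 h2 h3
  omega

/-- Nodal families are the preimages of the dual basis under `bubbleMoments`. -/
theorem isNodalFamily_iff {n : ℕ} {m : Fin 4} {ι : Type*} [DecidableEq ι]
    {q : Basis ι ℝ (polyOn (((n + 2 : ℕ) : ℤ) - 2) (face T m).closedInterior)}
    {φ : ι → E3 → ℝ} :
    IsNodalFamily T (n + 2) m q φ ↔ ∀ i, ∃ P, φ i = baryEval T (bubblePoly m ^ 2 * P.1) ∧
      bubbleMoments T m (n + 2) n P = (0, 0, q.coord i) := by
  refine forall_congr' fun i => ?_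
  have hn : ((n + 2 : ℕ) : ℤ) - 2 = n := by push_cast; ring
  have hmem : φ i ∈ bubbleSpace T m (((n + 2 : ℕ) : ℤ) - 2) ↔
      ∃ P : MvPolynomial.homogeneousSubmodule (Fin 4) ℝ n,
        φ i = baryEval T (bubblePoly m ^ 2 * P.1) := by
    rw [hn, mem_bubbleSpace_iff]
    simp
  rw [hmem, ← exists_and_right]
  refine exists_congr fun P => and_congr_right fun hφ => ?_
  rw [bubbleMoments_apply, Prod.mk.injEq, Prod.mk.injEq]
  refine and_congr ?_ (and_congr ?_ ?_)
  · rw [LinearMap.ext_iff, Subtype.forall, hφ]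
    rfl
  · rw [LinearMap.ext_iff, Subtype.forall, hφ]
    rfl
  · rw [hφ, normalDeriv_baryEval]
    constructor
    · intro h
      refine q.ext fun j => ?_
      rw [momentDual_apply, h j, Basis.coord_apply, Basis.repr_self, Finsupp.single_apply]
      simp only [eq_comm]
    · intro h j
      have h1 := LinearMap.congr_fun h (q j)
      rw [momentDual_apply, Basis.coord_apply, Basis.repr_self, Finsupp.single_apply] at h1
      rw [h1]
      simp only [eq_comm]

/-! ### The moments of the bubbles on the other faces and on the edges -/

theorem faceRestrict_bubblePoly {s : Finset (Fin 4)} {m : Fin 4} (h : ¬ {m}ᶜ ⊆ s) :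
    faceRestrict s (bubblePoly m) = 0 := by
  obtain ⟨i, hi, his⟩ := Finset.not_subset.mp h
  rw [bubblePoly, map_prod]
  exact Finset.prod_eq_zero hi (by rw [faceRestrict_X, if_neg his])

theorem momentDual_edge_bubble (e : EdgeIdx) (k : ℤ) (m : Fin 4) (P : MvPolynomial (Fin 4) ℝ) :
    momentDual (hasVertexSet_edge (T := T) e) k (bubblePoly m ^ 2 * P) = 0 := by
  refine momentDual_eq_zero_of_faceRestrict _ k ?_
  rw [map_mul, map_pow, faceRestrict_bubblePoly, zero_pow two_ne_zero, zero_mul]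
  intro h
  have := Finset.card_le_card h
  rw [card_compl_singleton, e.2] at this
  omega

theorem not_compl_singleton_subset {m m' : Fin 4} (h : m ≠ m') :
    ¬ ({m}ᶜ : Finset (Fin 4)) ⊆ {m'}ᶜ := fun h' => by
  simpa using h' (show m' ∈ ({m}ᶜ : Finset (Fin 4)) by simpa using h.symm)

theorem momentDual_face_bubble_of_ne {m m' : Fin 4} (h : m ≠ m') (k : ℤ)
    (P : MvPolynomial (Fin 4) ℝ) :
    momentDual (hasVertexSet_faceOpposite (T := T) m') k (bubblePoly m ^ 2 * P) = 0 := by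
  refine momentDual_eq_zero_of_faceRestrict _ k ?_
  rw [map_mul, map_pow, faceRestrict_bubblePoly (not_compl_singleton_subset h),
    zero_pow two_ne_zero, zero_mul]

theorem momentDual_dirDeriv_bubble_of_ne {m m' : Fin 4} (h : m ≠ m') (k : ℤ) (c : Fin 4 → ℝ)
    (P : MvPolynomial (Fin 4) ℝ) :
    momentDual (hasVertexSet_faceOpposite (T := T) m') k
      (dirDeriv c (bubblePoly m ^ 2 * P)) = 0 := by
  refine momentDual_eq_zero_of_faceRestrict _ k ?_
  have hb := faceRestrict_bubblePoly (not_compl_singleton_subset h)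
  rw [Derivation.leibniz, Derivation.leibniz_pow]
  simp [hb]

/-! ### The moments of polynomials -/

/-- The moments of a polynomial of degree `ℓ` on the edges, the faces and the tetrahedron, together
with the integrals of its normal derivatives over the faces. The latter are taken over the reference
triangle, that is, without the factor `d ! = 2` of a mean. -/
def coreMoments (T : Tetra) (ℓ : ℕ) :
    MvPolynomial.homogeneousSubmodule (Fin 4) ℝ ℓ →ₗ[ℝ]
      (∀ e : EdgeIdx, Dual ℝ (polyOn ((ℓ : ℤ) - 2) (edge T e).closedInterior)) ×
      (∀ m : Fin 4, Dual ℝ (polyOn ((ℓ : ℤ) - 3) (face T m).closedInterior)) ×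
      Dual ℝ (polyOn ((ℓ : ℤ) - 4) T.closedInterior) × (Fin 4 → ℝ) :=
  ((LinearMap.pi fun e => momentDual (hasVertexSet_edge e) _).prod
    ((LinearMap.pi fun m => momentDual (hasVertexSet_faceOpposite m) _).prod
      ((momentDual hasVertexSet_self _).prod
        (LinearMap.pi fun m =>
          dirichlet {m}ᶜ ∘ₗ (dirDeriv (normalSlope T m)).toLinearMap)))) ∘ₗ Submodule.subtype _

theorem coreMoments_apply (ℓ : ℕ) (P : MvPolynomial.homogeneousSubmodule (Fin 4) ℝ ℓ) :
    coreMoments T ℓ P = (fun e => momentDual (hasVertexSet_edge e) _ P.1,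
      fun m => momentDual (hasVertexSet_faceOpposite m) _ P.1,
      momentDual hasVertexSet_self _ P.1,
      fun m => dirichlet {m}ᶜ (dirDeriv (normalSlope T m) P.1)) := rfl

theorem coreMoments_injective (n : ℕ) : Function.Injective (coreMoments T (n + 2)) := by
  rw [← LinearMap.ker_eq_bot, LinearMap.ker_eq_bot']
  rintro ⟨P, hP⟩ h
  rw [coreMoments_apply, Prod.mk_eq_zero, Prod.mk_eq_zero, Prod.mk_eq_zero] at h
  obtain ⟨h1, h2, h3, h4⟩ := h
  refine Subtype.ext (eq_zero_of_moments (Fintype.card_fin 4) (Nat.succ_pos n)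
    (c := normalSlope T) (sum_normalSlope T) (normalSlope_self_ne_zero T) hP ?_ (congrFun h4))
  intro s hs Q k hQ hk
  have hs4 : s.card ≤ 4 := card_finset_fin_le s
  obtain hc | hc | hc : s.card = 2 ∨ s.card = 3 ∨ s.card = 4 := by omega
  · exact dirichlet_eq_zero_of_momentDual (hasVertexSet_edge ⟨s, hc⟩) (congrFun h1 ⟨s, hc⟩) hQ
      (by push_cast; omega)
  · obtain ⟨m, hm⟩ := Finset.card_eq_one.mp
      (show sᶜ.card = 1 by rw [Finset.card_compl, Fintype.card_fin, hc])
    obtain rfl : s = {m}ᶜ := by rw [← hm, compl_compl]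
    exact dirichlet_eq_zero_of_momentDual (hasVertexSet_faceOpposite m) (congrFun h2 m) hQ
      (by push_cast; omega)
  · obtain rfl : s = Finset.univ := by rw [← Finset.card_eq_iff_eq_univ, hc, Fintype.card_fin]
    exact dirichlet_eq_zero_of_momentDual hasVertexSet_self h3 hQ (by push_cast; omega)

theorem coreMoments_bijective (n : ℕ) : Function.Bijective (coreMoments T (n + 2)) := by
  have i1 := fun e => finiteDimensional_polyOn (hasVertexSet_edge (T := T) e)
    (((n + 2 : ℕ) : ℤ) - 2)
  have i2 := fun m => finiteDimensional_polyOn (hasVertexSet_faceOpposite (T := T) m)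
    (((n + 2 : ℕ) : ℤ) - 3)
  have i3 := finiteDimensional_polyOn (hasVertexSet_self (T := T)) (((n + 2 : ℕ) : ℤ) - 4)
  refine bijective_of_injective_of_finrank_le (coreMoments_injective n) ?_
  rw [finrank_prod, finrank_prod, finrank_prod, Module.finrank_pi_fintype,
    Module.finrank_pi_fintype, Subspace.dual_finrank_eq, finrank_homogeneousSubmodule,
    Module.finrank_fin_fun]
  simp only [Subspace.dual_finrank_eq]
  have h1 : ∑ e : EdgeIdx, finrank ℝ
      (polyOn (((n + 2 : ℕ) : ℤ) - 2) (edge T e).closedInterior) ≤ 6 * (n + 1) := by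
    have h : ∀ e ∈ (Finset.univ : Finset EdgeIdx), finrank ℝ
        (polyOn (((n + 2 : ℕ) : ℤ) - 2) (edge T e).closedInterior) ≤ n + 1 := by
      intro e _
      have h := finrank_polyOn_le (hasVertexSet_edge (T := T) e)
        (k := ((n + 2 : ℕ) : ℤ) - 2) (n := n + 1) (by rw [e.2]; push_cast; omega)
      simpa [e.2] using h
    have hcard : (Finset.univ : Finset EdgeIdx).card = 6 := by
      rw [Finset.card_univ, Fintype.card_finset_len, Fintype.card_fin]; rfl
    simpa [hcard] using Finset.sum_le_card_nsmul _ _ _ h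
  have h2 : ∑ m, finrank ℝ (polyOn (((n + 2 : ℕ) : ℤ) - 3) (face T m).closedInterior) ≤
      4 * (n + 1).choose 2 := by
    have h : ∀ m ∈ (Finset.univ : Finset (Fin 4)), finrank ℝ
        (polyOn (((n + 2 : ℕ) : ℤ) - 3) (face T m).closedInterior) ≤ (n + 1).choose 2 := by
      intro m _
      have h := finrank_polyOn_le (hasVertexSet_faceOpposite (T := T) m)
        (k := ((n + 2 : ℕ) : ℤ) - 3) (n := n + 1)
        (by rw [card_compl_singleton]; push_cast; omega)
      rwa [card_compl_singleton] at h
    simpa using Finset.sum_le_card_nsmul _ _ _ h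
  have h3 := finrank_polyOn_le (hasVertexSet_self (T := T)) (k := ((n + 2 : ℕ) : ℤ) - 4)
    (n := n + 1) (by rw [Finset.card_univ, Fintype.card_fin]; push_cast; omega)
  rw [Finset.card_univ, Fintype.card_fin] at h3
  have e1 : (n + 2 + 3).choose 3 = (n + 1).choose 3 + 4 * (n + 1).choose 2 + 6 * (n + 1) + 4 := by
    simp only [Nat.choose_succ_succ' _ 2, Nat.choose_succ_succ' _ 1, Nat.choose_succ_succ' _ 0,
      Nat.choose_zero_right, zero_add, Nat.choose_one_right]
    ring
  simp only [Nat.reduceSub] at h3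
  omega

/-! ### Unisolvence -/

/-- The dropped functions belong to the test functions `1`, so that the remaining ones do not affect
the means of the normal derivatives, which are at the disposal of `P_ℓ(T)`. -/
theorem unisolvent_of_isNodalFamily (T : Tetra) {n : ℕ} {ι : Fin 4 → Type*}
    [∀ m, DecidableEq (ι m)]
    (q : ∀ m, Basis (ι m) ℝ (polyOn (((n + 2 : ℕ) : ℤ) - 2) (face T m).closedInterior))
    (i₀ : ∀ m, ι m) (hi₀ : ∀ m x, (q m (i₀ m)).1 x = 1) (φ : ∀ m, ι m → E3 → ℝ)
    (hφ : ∀ m, IsNodalFamily T (n + 2) m (q m) (φ m)) :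
    Unisolvent T (n + 2) (enrichedSpace (n + 2) i₀ φ) := by
  choose P hPφ hP using fun m => isNodalFamily_iff.mp (hφ m)
  set R : ∀ m, ι m → MvPolynomial (Fin 4) ℝ := fun m i => bubblePoly m ^ 2 * (P m i).1 with hR
  have hP' : ∀ m i,
      momentDual (hasVertexSet_faceOpposite (T := T) m) (((n + 2 : ℕ) : ℤ) - 3) (R m i) = 0 ∧
      momentDual (hasVertexSet_self (T := T)) (((n + 2 : ℕ) : ℤ) - 4) (R m i) = 0 ∧
      momentDual (hasVertexSet_faceOpposite (T := T) m) (((n + 2 : ℕ) : ℤ) - 2)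
        (dirDeriv (normalSlope T m) (R m i)) = (q m).coord i := by
    intro m i
    have h := hP m i
    rwa [bubbleMoments_apply, Prod.mk.injEq, Prod.mk.injEq] at h
  -- the polynomials `b_{F_m}² P` whose moments on `F_m` and `T` vanish, a space on which the normal
  -- derivative moments are injective
  let N : Fin 4 → Submodule ℝ (MvPolynomial (Fin 4) ℝ) := fun m =>
    (MvPolynomial.homogeneousSubmodule (Fin 4) ℝ n).map (LinearMap.mulLeft ℝ (bubblePoly m ^ 2)) ⊓
      (LinearMap.ker (momentDual (hasVertexSet_faceOpposite (T := T) m) (((n + 2 : ℕ) : ℤ) - 3)) ⊓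
        LinearMap.ker (momentDual (hasVertexSet_self (T := T)) (((n + 2 : ℕ) : ℤ) - 4)))
  -- the span of the nodal functions that are not dropped
  let Sp : Submodule ℝ (MvPolynomial (Fin 4) ℝ) :=
    Submodule.span ℝ {S | ∃ m i, i ≠ i₀ m ∧ S = R m i}
  have hV : enrichedSpace (n + 2) i₀ φ = (MvPolynomial.homogeneousSubmodule (Fin 4) ℝ (n + 2) ⊔
      Sp).map (baryEval T).toLinearMap := by
    rw [Submodule.map_sup, enrichedSpace, polySpace_eq_map_baryEval T, Submodule.map_span]
    congr 2
    ext v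
    constructor
    · rintro ⟨m, i, hi, rfl⟩
      exact ⟨_, ⟨m, i, hi, rfl⟩, (hPφ m i).symm⟩
    · rintro ⟨_, ⟨m, i, hi, rfl⟩, rfl⟩
      exact ⟨m, i, hi, (hPφ m i).symm⟩
  have hSpN : Sp ≤ ⨆ m, N m := by
    refine Submodule.span_le.mpr ?_
    rintro _ ⟨m, i, -, rfl⟩
    exact Submodule.mem_iSup_of_mem m ⟨⟨_, (P m i).2, rfl⟩, (hP' m i).1, (hP' m i).2.1⟩
  have hdecomp : ∀ S ∈ Sp, ∃ S' : Fin 4 → MvPolynomial (Fin 4) ℝ,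
      (∀ m, S' m ∈ N m) ∧ ∑ m, S' m = S := by
    intro S hS
    obtain ⟨f, hf, hfS⟩ := (Submodule.mem_iSup_iff_exists_finsupp _ _).mp (hSpN hS)
    exact ⟨f, hf, by rw [← hfS, Finsupp.sum_fintype _ _ (by simp)]⟩
  have hSpE : ∀ S ∈ Sp, ∀ e, momentDual (hasVertexSet_edge (T := T) e)
      (((n + 2 : ℕ) : ℤ) - 2) S = 0 := by
    intro S hS e
    obtain ⟨S', hS', rfl⟩ := hdecomp S hS
    rw [map_sum]
    refine Finset.sum_eq_zero fun m _ => ?_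
    obtain ⟨⟨Q, -, hQ⟩, -⟩ := hS' m
    rw [← hQ]
    exact momentDual_edge_bubble e _ m Q
  have hSpF : ∀ S ∈ Sp, ∀ m, momentDual (hasVertexSet_faceOpposite (T := T) m)
      (((n + 2 : ℕ) : ℤ) - 3) S = 0 := by
    intro S hS m
    obtain ⟨S', hS', rfl⟩ := hdecomp S hS
    rw [map_sum]
    refine Finset.sum_eq_zero fun k _ => ?_
    obtain ⟨⟨Q, -, hQ⟩, hker, -⟩ := hS' k
    by_cases hkm : k = m
    · subst hkm; exact hker
    · rw [← hQ]
      exact momentDual_face_bubble_of_ne hkm _ Q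
  have hSpT : ∀ S ∈ Sp, momentDual (hasVertexSet_self (T := T)) (((n + 2 : ℕ) : ℤ) - 4) S = 0 := by
    intro S hS
    obtain ⟨S', hS', rfl⟩ := hdecomp S hS
    rw [map_sum]
    exact Finset.sum_eq_zero fun k _ => (hS' k).2.2
  -- the normal derivative moments of the nodal functions
  have hRN : ∀ m k i, momentDual (hasVertexSet_faceOpposite (T := T) m) (((n + 2 : ℕ) : ℤ) - 2)
      (dirDeriv (normalSlope T m) (R k i)) =
        if h : k = m then (q m).coord (h ▸ i) else 0 := by
    intro m k i
    split_ifs with h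
    · subst h; exact (hP' k i).2.2
    · exact momentDual_dirDeriv_bubble_of_ne h _ _ _
  -- the mean is the moment against the test function `1`; the factor `2` is `d !` on a triangle
  have hone : ∀ m W, dirichlet {m}ᶜ (dirDeriv (normalSlope T m) W) =
      momentDual (hasVertexSet_faceOpposite (T := T) m) (((n + 2 : ℕ) : ℤ) - 2)
        (dirDeriv (normalSlope T m) W) (q m (i₀ m)) / 2 := by
    intro m W
    have h1 : (q m (i₀ m)).1 = fun x : (face T m).closedInterior => baryEval T 1 x.1 := by
      ext x; rw [hi₀]; simp
    rw [momentDual_apply, h1, (hasVertexSet_faceOpposite (T := T) m).moment_baryEval, mul_one]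
    norm_num
  have hSpN0 : ∀ S ∈ Sp, ∀ m, dirichlet {m}ᶜ (dirDeriv (normalSlope T m) S) = 0 := by
    intro S hS m
    have hle : Sp ≤ LinearMap.ker (dirichlet {m}ᶜ ∘ₗ (dirDeriv (normalSlope T m)).toLinearMap) := by
      refine Submodule.span_le.mpr ?_
      rintro _ ⟨k, i, hi, rfl⟩
      change dirichlet {m}ᶜ (dirDeriv (normalSlope T m) (R k i)) = 0
      rw [hone, hRN]
      split_ifs with h
      · subst h
        simp [hi.symm]
      · simp
    exact hle hS
  have hSp0 : ∀ S ∈ Sp, (∀ m, momentDual (hasVertexSet_faceOpposite (T := T) m)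
      (((n + 2 : ℕ) : ℤ) - 2) (dirDeriv (normalSlope T m) S) = 0) → S = 0 := by
    intro S hS h
    obtain ⟨S', hS', rfl⟩ := hdecomp S hS
    refine Finset.sum_eq_zero fun m _ => ?_
    have h1 := h m
    rw [map_sum, map_sum, Finset.sum_eq_single_of_mem m (Finset.mem_univ m)] at h1
    · obtain ⟨⟨Q, hQh, hQ⟩, hk1, hk2⟩ := hS' m
      replace hk1 := LinearMap.mem_ker.mp hk1
      replace hk2 := LinearMap.mem_ker.mp hk2
      rw [← hQ, LinearMap.mulLeft_apply] at h1 hk1 hk2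
      have h2 : bubbleMoments T m (n + 2) n ⟨Q, hQh⟩ = 0 := by
        rw [bubbleMoments_apply, Prod.mk_eq_zero, Prod.mk_eq_zero]
        exact ⟨hk1, hk2, h1⟩
      have h3 := (map_eq_zero_iff _ (bubbleMoments_injective m n)).mp h2
      rw [← hQ, show Q = 0 from congrArg Subtype.val h3, map_zero]
    · intro k _ hkm
      obtain ⟨⟨Q, -, hQ⟩, -⟩ := hS' k
      rw [← hQ]
      exact momentDual_dirDeriv_bubble_of_ne hkm _ _ _
  intro a b c d
  refine existsUnique_of_exists_of_unique ?_ ?_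
  · obtain ⟨W, hW⟩ := (coreMoments_bijective (T := T) n).2
      (a, b, c, fun m => d m (q m (i₀ m)) / 2)
    rw [coreMoments_apply, Prod.mk.injEq, Prod.mk.injEq, Prod.mk.injEq] at hW
    obtain ⟨hWa, hWb, hWc, hWd⟩ := hW
    have i3 := fun m => finiteDimensional_polyOn (hasVertexSet_faceOpposite (T := T) m)
      (((n + 2 : ℕ) : ℤ) - 2)
    let fι : ∀ m, Fintype (ι m) := fun m => FiniteDimensional.fintypeBasisIndex (q m)
    -- the defect of the normal derivative moments of `W`; it vanishes at the dropped functions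
    let t : ∀ m, Dual ℝ (polyOn (((n + 2 : ℕ) : ℤ) - 2) (face T m).closedInterior) := fun m =>
      d m - momentDual (hasVertexSet_faceOpposite m) _ (dirDeriv (normalSlope T m) W.1)
    have ht0 : ∀ m, t m (q m (i₀ m)) = 0 := by
      intro m
      have h1 := congrFun hWd m
      rw [hone] at h1
      simp only [t, LinearMap.sub_apply]
      linarith
    let S : MvPolynomial (Fin 4) ℝ := ∑ m, ∑ i, t m (q m i) • R m i
    have hS : S ∈ Sp := by
      refine Submodule.sum_mem _ fun m _ => Submodule.sum_mem _ fun i _ => ?_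
      by_cases hi : i = i₀ m
      · rw [hi, ht0, zero_smul]; exact Submodule.zero_mem _
      · exact Submodule.smul_mem _ _ (Submodule.subset_span ⟨m, i, hi, rfl⟩)
    refine ⟨baryEval T (W.1 + S), ?_, ?_, ?_, ?_, ?_⟩
    · rw [hV]
      exact ⟨_, Submodule.add_mem_sup W.2 hS, rfl⟩
    · intro e p
      rw [← momentDual_apply (hasVertexSet_edge e), map_add, hSpE S hS, add_zero]
      exact LinearMap.congr_fun (congrFun hWa e) p
    · intro m p
      rw [← momentDual_apply (hasVertexSet_faceOpposite m), map_add, hSpF S hS, add_zero]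
      exact LinearMap.congr_fun (congrFun hWb m) p
    · intro p
      rw [← momentDual_apply hasVertexSet_self, map_add, hSpT S hS, add_zero]
      exact LinearMap.congr_fun hWc p
    · intro m p
      rw [normalDeriv_baryEval, ← momentDual_apply (hasVertexSet_faceOpposite m), map_add, map_add]
      have h1 : momentDual (hasVertexSet_faceOpposite (T := T) m) (((n + 2 : ℕ) : ℤ) - 2)
          (dirDeriv (normalSlope T m) S) = t m := by
        refine (q m).ext fun j => ?_
        simp only [S, map_sum, Derivation.map_smul, map_smul, hRN]
        rw [Finset.sum_eq_single_of_mem m (Finset.mem_univ m)]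
        · simp
        · intro k _ hk
          simp [hk]
      rw [h1]
      simp [t]
  · rintro v v' ⟨hv, hva, hvb, hvc, hvd⟩ ⟨hv', hva', hvb', hvc', hvd'⟩
    rw [← sub_eq_zero]
    rw [hV] at hv hv'
    obtain ⟨Q, hQ, rfl⟩ := hv
    obtain ⟨Q', hQ', rfl⟩ := hv'
    obtain ⟨W, hW, S, hS, hWS⟩ := Submodule.mem_sup.mp (Submodule.sub_mem _ hQ hQ')
    simp only [AlgHom.toLinearMap_apply] at hva hvb hvc hvd hva' hvb' hvc' hvd' ⊢
    rw [← map_sub, ← hWS]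
    have hE : ∀ e, momentDual (hasVertexSet_edge (T := T) e) (((n + 2 : ℕ) : ℤ) - 2)
        (W + S) = 0 := by
      intro e
      ext p
      rw [hWS, map_sub, LinearMap.sub_apply, momentDual_apply, momentDual_apply, hva, hva',
        sub_self, LinearMap.zero_apply]
    have hF : ∀ m, momentDual (hasVertexSet_faceOpposite (T := T) m) (((n + 2 : ℕ) : ℤ) - 3)
        (W + S) = 0 := by
      intro m
      ext p
      rw [hWS, map_sub, LinearMap.sub_apply, momentDual_apply, momentDual_apply, hvb, hvb',
        sub_self, LinearMap.zero_apply]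
    have hT : momentDual (hasVertexSet_self (T := T)) (((n + 2 : ℕ) : ℤ) - 4) (W + S) = 0 := by
      ext p
      rw [hWS, map_sub, LinearMap.sub_apply, momentDual_apply, momentDual_apply, hvc, hvc',
        sub_self, LinearMap.zero_apply]
    have hN : ∀ m, momentDual (hasVertexSet_faceOpposite (T := T) m) (((n + 2 : ℕ) : ℤ) - 2)
        (dirDeriv (normalSlope T m) (W + S)) = 0 := by
      intro m
      ext p
      rw [hWS, map_sub, map_sub, LinearMap.sub_apply, momentDual_apply, momentDual_apply,
        ← normalDeriv_baryEval, ← normalDeriv_baryEval, hvd, hvd', sub_self, LinearMap.zero_apply]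
    have hW0 : coreMoments T (n + 2) ⟨W, hW⟩ = 0 := by
      rw [coreMoments_apply, Prod.mk_eq_zero, Prod.mk_eq_zero, Prod.mk_eq_zero]
      refine ⟨funext fun e => ?_, funext fun m => ?_, ?_, funext fun m => ?_⟩
      · have h1 := hE e
        rwa [map_add, hSpE S hS, add_zero] at h1
      · have h1 := hF m
        rwa [map_add, hSpF S hS, add_zero] at h1
      · have h1 := hT
        rwa [map_add, hSpT S hS, add_zero] at h1
      · have h1 := hone m (W + S)
        rw [hN, map_add, map_add, hSpN0 S hS, add_zero] at h1
        simpa using h1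
    have hW1 : W = 0 :=
      congrArg Subtype.val ((map_eq_zero_iff _ (coreMoments_injective n)).mp hW0)
    rw [hW1, zero_add] at hN ⊢
    rw [hSp0 S hS hN, map_zero]

end Unisolvence

end TetraFE

end

open TetraFE
theorem mainTheorem2 (ℓ : ℕ) (hℓ : 3 ≤ ℓ) (T : Tetra)
    {ι : Fin 4 → Type*} [∀ m, DecidableEq (ι m)]
    (q : ∀ m, Module.Basis (ι m) ℝ (polyOn ((ℓ : ℤ) - 2) (face T m).closedInterior))
    (i₀ : ∀ m, ι m) (hi₀ : ∀ m x, (q m (i₀ m)).1 x = 1) :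
    (∃! φ : ∀ m, ι m → E3 → ℝ, ∀ m, IsNodalFamily T ℓ m (q m) (φ m)) ∧
      ∀ φ : ∀ m, ι m → E3 → ℝ, (∀ m, IsNodalFamily T ℓ m (q m) (φ m)) →
        Unisolvent T ℓ (enrichedSpace ℓ i₀ φ) := by
  obtain ⟨n, rfl⟩ : ∃ n, ℓ = n + 2 := ⟨ℓ - 2, by omega⟩
  refine ⟨?_, fun φ hφ => unisolvent_of_isNodalFamily T q i₀ hi₀ φ hφ⟩
  have h := fun m => bubbleMoments_bijective (T := T) m n
  choose P hP using fun m i => (h m).2 (0, 0, (q m).coord i)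
  refine ⟨fun m i => baryEval T (bubblePoly m ^ 2 * (P m i).1),
    fun m => isNodalFamily_iff.mpr fun i => ⟨P m i, rfl, hP m i⟩, fun φ hφ => ?_⟩
  ext m i x
  obtain ⟨Q, hφQ, hQ⟩ := isNodalFamily_iff.mp (hφ m) i
  rw [hφQ, (h m).1 (hQ.trans (hP m i).symm)]
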